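/- **Setting.** Let $p,L,r\in\mathbb N$ ($p,L,r\ge1$), $P=(p+1)r+(L-1)(r+1)r+r+1$. For $\theta\in\mathbb R^P$ let $g_\theta:\mathbb R^p\to\mathbb R$ be the fully connected ReLU network with $L$ hidden layers of width $r$ whose weights and shifts are the entries of $\theta$, and for $C\ge1$ let $f_\theta=(-C)\vee(g_\theta\wedge C)$. Let $(\mathbf X,Y)$ be random variables with values in $\mathbb R^p\times\mathbb R$, $Y=f(\mathbf X)+\varepsilon$, $\mathbb E[\varepsilon\mid\mathbf X]=0$ a.s., where, for constants $K\ge 1$ and $\sigma,\Gamma>0$: $|f|\le C$ holds $\mathbb P^{\mathbf X}$-a.e.; $\mathbb E[|\mathbf X|^2]\le K$; $\mathbb E[|\varepsilon|^k\mid\mathbf X]\le\frac{k!}{2}\sigma^2\Gamma^{k-2}$ a.s. for all integers $k\ge2$; and $\varepsilon$ is symmetric conditionally on $\mathbf X$. Let $\mathcal D_n=(\mathbf X_i,Y_i)_{i\le n}$ be i.i.d. copies of $(\mathbf X,Y)$. Put $R(h)=\mathbb E[(Y-h(\mathbf X))^2]$, $\mathcal E(h)=R(h)-R(f)$, and let $\theta^*$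 minimize $\theta\mapsto R(f_\theta)$ over $[-B,B]^P$, where $B\ge1$. For $\rho\in(0,1]$, $\lambda>0$ and $\ell_i(\theta)=(Y_i-f_\theta(\mathbf X_i))^2$ let $$\tilde R_{n,\rho}(\theta)=-\frac1\lambda\sum_{i=1}^n\log\big(e^{-\frac\lambda n\ell_i(\theta)}+1-\rho\big),$$ let $\tilde\Pi_{\lambda,\rho}(\cdot\mid\mathcal D_n)$ be the probability measure with density proportional to $e^{-\lambda\tilde R_{n,\rho}}$ with respect to the uniform distribution on $[-B,B]^P$, and let $\bar f_{\lambda,\rho}=\int f_\theta\,\tilde\Pi_{\lambda,\rho}(d\theta\mid\mathcal D_n)$. Write $\|\cdot\|$ for the norm of $L^2=L^2(\mathbb P^{\mathbf X})$ and, for $\alpha\in(0,1)$, $$\widehat C(\tau)=\{h\in L^2:\|h-\bar f_{\lambda,\rho}\|\le\tau\},\qquad \tau_\alpha=\inf\{\tau>0:\tilde\Pi_{\lambda,\rho}(\theta:\|f_\theta-\bar f_{\lambda,\rho}\|\le\tau\mid\mathcal D_n)>1-\alpha\},$$ $$\tau^\theta_\alpha=\inf\{\tau>0:\tilde\Pi_{\lambda,\rho}(\theta:|\theta|_\infty\le(2rB)^{-L}\tau\mid\mathcal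 D_n)>1-\alpha\}.$$ **Theorem (Credible balls).** For all $C\ge1$, $\sigma,\Gamma>0$ there are constants $\Xi_0,\Xi_1,\Xi_2>0$ depending only on $C,\sigma,\Gamma$ such that the following holds in the above setting for all $n\ge\max\{2,B,K,L,r,p\}$. 0. (Meaning of the constants.) For $\lambda=n/\Xi_0$ and all $\delta\in(0,1)$: if, given $\mathcal D_n$, $\tilde\theta$ is drawn from $\tilde\Pi_{\lambda,\rho}(\cdot\mid\mathcal D_n)$, then with probability at least $1-\delta$ (with respect to the data and the draw) $$\mathcal E(f_{\tilde\theta})\le12\,\mathcal E(f_{\theta^*})+\frac{\Xi_1}{n}\big(PL\log n+\log(2/\delta)\big),$$ and with probability at least $1-\delta$ $$\mathcal E(\bar f_{\lambda,\rho})\le12\,\mathcal E(f_{\theta^*})+\frac{\Xi_2}{n}\big(PL\log n+\log(2/\delta)\big).$$ 1. (Diameter.) For $\lambda=n/(2\Xi_0)$, $r_n^2=12\|f_{\theta^*}-f\|^2+\frac{\Xi_1}{n}PL\log n$ and every $\alpha\in(0,1)$, $$\mathbb P\Big(\operatorname{diam}\widehat C(\tau_\alpha)\le4\sqrt{2r_n^2+\tfrac{4(\Xi_1\vee\Xi_2)}{n}\log\tfrac2\alpha}\Big)\ge1-\alpha.$$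 2. (Coverage.) Let $\lambda=n/(2\Xi_0)$. For all $K\ge1$, $p\ge1$, $\alpha\in(0,1)$ and $A>0$ there is a constant $\kappa>1$, depending only on $K,p,\alpha,A$ and on $C,\sigma,\Gamma$, such that whenever $L\log(n)\,\mathcal E(f_{\theta^*})\le A\,PL\log(n)/\lambda$, one has, with $\xi=\kappa\sqrt{L\log n}>\sqrt{L\log n}$, $$\mathbb P\big(f\in\widehat C(\xi\,\tau^\theta_\alpha)\big)\ge1-\alpha.$$ -/

import Mathlib

open MeasureTheory ProbabilityTheory
open scoped ENNReal

namespace CredibleBalls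

/-! ### Fully connected ReLU networks -/

/-- Positions of the network parameters for input dimension `p`, `L` hidden layers and width `r`:
the first hidden layer, the hidden layers `2, …, L`, and the scalar output layer.
The last index is `some j` for the entry in column `j` of the weight matrix and `none` for the
entry of the shift vector. -/
abbrev ParamIndex (p L r : ℕ) : Type :=
  (Fin r × Option (Fin p)) ⊕ ((Fin (L - 1) × Fin r × Option (Fin r)) ⊕ Option (Fin r))

/-- The parameter space `ℝ^P`; its norm is the maximum norm. -/
abbrev Param (p L r : ℕ) : Type := ParamIndex p L r → ℝ

/-- The total number of network parameters. -/
def numParams (p L r : ℕ) : ℕ := (p + 1) * r + (L - 1) * (r + 1) * r + r + 1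

theorem card_paramIndex (p L r : ℕ) : Fintype.card (ParamIndex p L r) = numParams p L r := by
  simp [ParamIndex, numParams]
  ring

variable {p L r : ℕ}

/-- `hidden θ x k` is the output of the `(k + 1)`-st hidden layer, for `k < L`. -/
noncomputable def hidden (θ : Param p L r) (x : EuclideanSpace ℝ (Fin p)) : ℕ → Fin r → ℝ
  | 0 => fun i => max ((∑ j, θ (.inl (i, some j)) * x j) + θ (.inl (i, none))) 0
  | k + 1 => fun i =>
      if h : k < L - 1 then
        max ((∑ j, θ (.inr (.inl (⟨k, h⟩, i, some j))) * hidden θ x k j)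
          + θ (.inr (.inl (⟨k, h⟩, i, none)))) 0
      else 0

/-- The network `g_θ` (with `1 ≤ L` hidden layers). -/
noncomputable def network (θ : Param p L r) (x : EuclideanSpace ℝ (Fin p)) : ℝ :=
  (∑ j, θ (.inr (.inr (some j))) * hidden θ x (L - 1) j) + θ (.inr (.inr none))

/-- The clipped network `f_θ = (-C) ∨ (g_θ ∧ C)`. -/
noncomputable def clipped (C : ℝ) (θ : Param p L r) (x : EuclideanSpace ℝ (Fin p)) : ℝ :=
  max (-C) (min (network θ x) C)

/-- The cube `[-B, B]^P`. -/
def cube (p L r : ℕ) (B : ℝ) : Set (Param p L r) := Set.Icc (fun _ => -B) (fun _ => B)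

/-- The prior: the uniform distribution on the cube. -/
noncomputable def prior (p L r : ℕ) (B : ℝ) : Measure (Param p L r) :=
  ProbabilityTheory.cond volume (cube p L r B)

/-! ### The regression model -/

section Model

variable {Ω : Type*} [MeasurableSpace Ω]

/-- The regression model `Y = f(X) + ε` with `E[ε | X] = 0`, a regression function bounded by `C`,
second moment of the input at most `K`, and conditionally sub-Gaussian (with constants `σ, Γ`)
and conditionally symmetric noise `ε`. -/
structure IsBoundedRegression (P : Measure Ω) [IsProbabilityMeasure P]
    (X : Ω → EuclideanSpace ℝ (Fin p)) (Y : Ω → ℝ) (f : EuclideanSpace ℝ (Fin p) → ℝ)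
    (C K σ Γ : ℝ) : Prop where
  measurable_X : Measurable X
  measurable_Y : Measurable Y
  measurable_f : Measurable f
  integrable_noise : Integrable (fun ω => Y ω - f (X ω)) P
  condExp_noise :
    P[(fun ω => Y ω - f (X ω)) | MeasurableSpace.comap X inferInstance] =ᵐ[P] 0
  bounded : ∀ᵐ x ∂(P.map X), |f x| ≤ C
  integrable_input : Integrable (fun ω => ‖X ω‖ ^ 2) P
  second_moment : ∫ ω, ‖X ω‖ ^ 2 ∂P ≤ K
  integrable_moments : ∀ k : ℕ, 2 ≤ k → Integrable (fun ω => |Y ω - f (X ω)| ^ k) P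
  conditional_moments : ∀ k : ℕ, 2 ≤ k →
    ∀ᵐ ω ∂P, (P[(fun ω => |Y ω - f (X ω)| ^ k) | MeasurableSpace.comap X inferInstance]) ω
      ≤ (k.factorial : ℝ) / 2 * σ ^ 2 * Γ ^ (k - 2)
  conditional_symmetry : ∀ᵐ x ∂(P.map X),
    (condDistrib (fun ω => Y ω - f (X ω)) X P x).map (fun e => -e)
      = condDistrib (fun ω => Y ω - f (X ω)) X P x

/-- `D` consists of `n` i.i.d. copies of `(X, Y)`. -/
structure IsSample (P : Measure Ω) (X : Ω → EuclideanSpace ℝ (Fin p)) (Y : Ω → ℝ) {n : ℕ}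
    (D : Fin n → Ω → EuclideanSpace ℝ (Fin p) × ℝ) : Prop where
  identDistrib : ∀ i, IdentDistrib (D i) (fun ω => (X ω, Y ω)) P P
  indep : iIndepFun D P

/-- The prediction risk `R(h) = E[(Y - h(X))²]`. -/
noncomputable def risk (P : Measure Ω) (X : Ω → EuclideanSpace ℝ (Fin p)) (Y : Ω → ℝ)
    (h : EuclideanSpace ℝ (Fin p) → ℝ) : ℝ :=
  ∫ ω, (Y ω - h (X ω)) ^ 2 ∂P

/-- The excess risk `ℰ(h) = R(h) - R(f)`. -/
noncomputable def excessRisk (P : Measure Ω) (X : Ω → EuclideanSpace ℝ (Fin p)) (Y : Ω → ℝ)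
    (f h : EuclideanSpace ℝ (Fin p) → ℝ) : ℝ :=
  risk P X Y h - risk P X Y f

/-- `θs` is an oracle: it minimizes the prediction risk over the cube. -/
def IsOracle (P : Measure Ω) (X : Ω → EuclideanSpace ℝ (Fin p)) (Y : Ω → ℝ) (C B : ℝ)
    (θs : Param p L r) : Prop :=
  θs ∈ cube p L r B ∧ IsMinOn (fun θ => risk P X Y (clipped C θ)) (cube p L r B) θs

end Model

/-! ### The surrogate posterior and its mean -/

/-- The loss `ℓ(θ) = (y - f_θ(x))²` at the data point `z = (x, y)`. -/
noncomputable def loss (C : ℝ) (z : EuclideanSpace ℝ (Fin p) × ℝ) (θ : Param p L r) : ℝ :=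
  (z.2 - clipped C θ z.1) ^ 2

/-- The corrected stochastic empirical risk
`-(1/lam) ∑ i, log (exp (-(lam/n) ℓ_i(θ)) + 1 - ρ)` for given data `d`. -/
noncomputable def surrogateRisk {n : ℕ} (C lam ρ : ℝ) (d : Fin n → EuclideanSpace ℝ (Fin p) × ℝ)
    (θ : Param p L r) : ℝ :=
  -(1 / lam) * ∑ i, Real.log (Real.exp (-(lam / n) * loss C (d i) θ) + 1 - ρ)

/-- The surrogate posterior: the probability measure with density proportional to
`exp (-lam * surrogateRisk)` with respect to the prior. -/
noncomputable def surrogatePosterior (L r : ℕ) {n : ℕ} (C B lam ρ : ℝ)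
    (d : Fin n → EuclideanSpace ℝ (Fin p) × ℝ) : Measure (Param p L r) :=
  (prior p L r B).tilted (fun θ => -lam * surrogateRisk C lam ρ d θ)

/-- The posterior mean `x ↦ ∫ f_θ(x) dΠ(θ)`. -/
noncomputable def posteriorMean (L r : ℕ) {n : ℕ} (C B lam ρ : ℝ)
    (d : Fin n → EuclideanSpace ℝ (Fin p) × ℝ) (x : EuclideanSpace ℝ (Fin p)) : ℝ :=
  ∫ θ, clipped C θ x ∂(surrogatePosterior L r C B lam ρ d)

/-! ### Credible balls -/

/-- The norm of `L²(μ)`. -/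
noncomputable def l2Norm (μ : Measure (EuclideanSpace ℝ (Fin p)))
    (h : EuclideanSpace ℝ (Fin p) → ℝ) : ℝ :=
  (eLpNorm h 2 μ).toReal

/-- The `L²(μ)`-diameter of a set of functions. -/
noncomputable def l2Diam (μ : Measure (EuclideanSpace ℝ (Fin p)))
    (S : Set (EuclideanSpace ℝ (Fin p) → ℝ)) : ℝ≥0∞ :=
  ⨆ g ∈ S, ⨆ h ∈ S, eLpNorm (fun x => g x - h x) 2 μ

/-- The ball `{h ∈ L²(μ) : ‖h - c‖ ≤ τ}`. -/
def l2Ball (μ : Measure (EuclideanSpace ℝ (Fin p))) (c : EuclideanSpace ℝ (Fin p) → ℝ) (τ : ℝ) :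
    Set (EuclideanSpace ℝ (Fin p) → ℝ) :=
  {h | MemLp h 2 μ ∧ l2Norm μ (fun x => h x - c x) ≤ τ}

/-- The critical value `τ_α`, where `μ` is the distribution of the input. -/
noncomputable def criticalValue (L r : ℕ) {n : ℕ} (C B lam ρ : ℝ)
    (μ : Measure (EuclideanSpace ℝ (Fin p))) (d : Fin n → EuclideanSpace ℝ (Fin p) × ℝ)
    (α : ℝ) : ℝ :=
  sInf {τ : ℝ | 0 < τ ∧ 1 - α < (surrogatePosterior L r C B lam ρ d).real
    {θ | l2Norm μ (fun x => clipped C θ x - posteriorMean L r C B lam ρ d x) ≤ τ}}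

/-- The critical value `τ_α^θ` on the level of the parameters, with `Δ(L, r) = (2rB)^L`. -/
noncomputable def paramCriticalValue (L r : ℕ) {n : ℕ} (C B lam ρ : ℝ)
    (d : Fin n → EuclideanSpace ℝ (Fin p) × ℝ) (α : ℝ) : ℝ :=
  sInf {τ : ℝ | 0 < τ ∧ 1 - α < (surrogatePosterior L r C B lam ρ d).real
    {θ | ‖θ‖ ≤ ((2 * (r : ℝ) * B) ^ L)⁻¹ * τ}}

/-- The credible ball of radius `τ` around the posterior mean. -/
def credibleBall (L r : ℕ) {n : ℕ} (C B lam ρ : ℝ)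
    (μ : Measure (EuclideanSpace ℝ (Fin p))) (d : Fin n → EuclideanSpace ℝ (Fin p) × ℝ) (τ : ℝ) :
    Set (EuclideanSpace ℝ (Fin p) → ℝ) :=
  l2Ball μ (posteriorMean L r C B lam ρ d) τ

/-- The squared rate `r_n² = 12 ‖f_{θ*} - f‖² + (Ξ₁ / n) P L log n`. -/
noncomputable def rateSq (C Ξ₁ : ℝ) (n : ℕ) (μ : Measure (EuclideanSpace ℝ (Fin p)))
    (f : EuclideanSpace ℝ (Fin p) → ℝ) (θs : Param p L r) : ℝ :=
  12 * l2Norm μ (fun x => clipped C θs x - f x) ^ 2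
    + Ξ₁ / n * (numParams p L r * L * Real.log n)

/-- The sample size dominates `2`, `B`, `K`, `L`, `r` and `p`. -/
def IsLargeSample (n p L r : ℕ) (B K : ℝ) : Prop :=
  2 ≤ n ∧ B ≤ n ∧ K ≤ n ∧ L ≤ n ∧ r ≤ n ∧ p ≤ n

end CredibleBalls

open CredibleBalls

namespace CredibleBalls

/-! For `λ = n / Ξ` the surrogate posterior is the Bayes posterior of a product likelihood: an
observation with residual `u` contributes `exp (-u² / Ξ) + 1 - ρ`. All likelihoods are compared with
the one at `f`. Let `s(θ)` be the squared L²-distance of `f_θ` from `f`, which equals the excess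
risk (`IsBoundedRegression.excessRisk_eq`). Conditional symmetry of the noise turns the term linear
in the noise into a hyperbolic cosine. For large `Ξ`, uniformly in `ρ`, the likelihood ratio of one
observation therefore has mean at most `exp (-s / (4Ξ))`, and its inverse has mean at most `exp (3s
/ (2Ξ))` (`IsBoundedRegression.lintegral_ratio_le`, `IsBoundedRegression.lintegral_ratio_inv_le`).

A posterior mean of some `k ≥ 0` is a quotient. By Fubini the expected numerator is at most the
prior mean of `k * exp (-n s / (4Ξ))`. By Cauchy–Schwarz the denominator is at least `π(S)²` divided
by the integral over `S` of the inverse likelihood ratio, whose expectation is also controlled. Two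
applications of Markov's inequality give `exists_event_lintegral_posterior_le`; no supremum over `θ`
has to be bounded. Here `S` is a ball around `θ*`, on which the Lipschitz bound for networks keeps
`s` below `2 s(θ*)` plus a small term.

Two choices of `k` suffice. The choice `k = exp (n s / (4Ξ))` gives an exponential posterior moment
of `s`, hence the oracle inequalities for a draw and, by Jensen, for the posterior mean
(`IsBoundedRegression.exists_oracle_event`); the factor 12 is `4Ξ · 3/(2Ξ) · 2`. The diameter bound
follows because most draws and the posterior mean are both close to `f`.

For coverage, `k` is the indicator of a parameter ball around 0 of radius `(2rB)^(-L) ζ √(P/n)`, and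
`S` has radius `(2rB)^(-L) √(P/n)`. The prior masses contribute a factor `(2ζ)^P`, which for small
`ζ` beats the exponential cost of order `exp (cP)`. Hence `τ_α^θ ≥ ζ √(P/n)`
(`IsBoundedRegression.exists_small_ball_event`). The posterior mean has distance of order `√(P L log
n / n)` from `f`, and inflation by a multiple of `√(L log n)` closes the gap. -/

/-! ### Symmetric noise with Bernstein moments -/

/-- A symmetric distribution on `ℝ` satisfying Bernstein's moment condition. -/
structure IsSymmetricBernstein (ν : Measure ℝ) (σ Γ : ℝ) : Prop where
  map_neg : ν.map (fun e => -e) = ν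
  lintegral_pow_le : ∀ k : ℕ, 2 ≤ k →
    ∫⁻ e, ENNReal.ofReal (|e| ^ k) ∂ν ≤ ENNReal.ofReal (k.factorial / 2 * σ ^ 2 * Γ ^ (k - 2))

theorem hasSum_choose_two_half : HasSum (fun k : ℕ => ((k + 2).choose 2 : ℝ) * (1 / 2) ^ k) 8 := by
  have h : ‖(1 / 2 : ℝ)‖ < 1 := by norm_num [Real.norm_eq_abs, abs_of_pos]
  have := (summable_choose_mul_geometric_of_norm_lt_one 2 h).hasSum
  rw [tsum_choose_mul_geometric_of_norm_lt_one 2 h] at this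
  norm_num at this ⊢
  exact this

theorem cosh_sub_one_le (y : ℝ) : Real.cosh y - 1 ≤ y ^ 2 * Real.exp |y| := by
  have key : ∀ z : ℝ, Real.exp z - 1 - z ≤ z ^ 2 * Real.exp |z| := fun z => by
    have := Complex.norm_exp_sub_sum_le_norm_mul_exp (z : ℂ) 2
    simp only [Finset.sum_range_succ, Finset.sum_range_zero, zero_add, pow_zero, pow_one,
      Nat.factorial, Nat.cast_one, div_one, mul_one, Complex.norm_real, Real.norm_eq_abs,
      sq_abs, Nat.succ_eq_add_one] at this
    rw [show Complex.exp (z : ℂ) - (1 + (z : ℂ)) = ((Real.exp z - (1 + z) : ℝ) : ℂ) by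
      push_cast; rfl, Complex.norm_real, Real.norm_eq_abs] at this
    linarith [le_abs_self (Real.exp z - (1 + z))]
  have h1 := key y
  have h2 := key (-y)
  rw [abs_neg, neg_sq] at h2
  rw [Real.cosh_eq]
  linarith

namespace IsSymmetricBernstein

variable {ν : Measure ℝ} {σ Γ : ℝ}

/-- Expanding the exponential, Bernstein's condition bounds the `k`-th term by `σ² (k+2 choose 2)
(sΓ)^k`. With `sΓ ≤ 1/2` the series sums to `8σ²`. Working with `∫⁻` gives integrability at the same
time. -/
theorem lintegral_sq_mul_exp_le (h : IsSymmetricBernstein ν σ Γ) (hΓ : 0 ≤ Γ) {s : ℝ}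
    (hs : 0 ≤ s) (hsΓ : s * Γ ≤ 1 / 2) :
    ∫⁻ e, ENNReal.ofReal (e ^ 2 * Real.exp (s * |e|)) ∂ν ≤ ENNReal.ofReal (8 * σ ^ 2) := by
  have h1 : ∀ e : ℝ, ENNReal.ofReal (e ^ 2 * Real.exp (s * |e|))
      = ∑' k : ℕ, ENNReal.ofReal (s ^ k / k.factorial) * ENNReal.ofReal (|e| ^ (k + 2)) := by
    intro e
    have hsum : HasSum (fun k : ℕ => (s ^ k / k.factorial) * |e| ^ (k + 2))
        (e ^ 2 * Real.exp (s * |e|)) := by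
      have := (NormedSpace.expSeries_div_hasSum_exp (s * |e|)).mul_left (e ^ 2)
      rw [← Real.exp_eq_exp_ℝ] at this
      refine this.congr_fun ?_ |> id
      intro k
      rw [← sq_abs e]
      ring
    rw [← hsum.tsum_eq, ENNReal.ofReal_tsum_of_nonneg (fun k => by positivity) hsum.summable]
    exact tsum_congr fun k => ENNReal.ofReal_mul (by positivity)
  simp_rw [h1]
  rw [lintegral_tsum (fun k => by fun_prop)]
  have h8 : HasSum (fun k : ℕ => σ ^ 2 * (((k + 2).choose 2 : ℝ) * (1 / 2) ^ k)) (σ ^ 2 * 8) :=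
    hasSum_choose_two_half.mul_left _
  rw [mul_comm 8, ← h8.tsum_eq, ENNReal.ofReal_tsum_of_nonneg (fun k => by positivity) h8.summable]
  refine ENNReal.tsum_le_tsum fun k => ?_
  rw [lintegral_const_mul _ (by fun_prop)]
  calc _ ≤ ENNReal.ofReal (s ^ k / k.factorial)
        * ENNReal.ofReal ((k + 2).factorial / 2 * σ ^ 2 * Γ ^ (k + 2 - 2)) := by
        gcongr
        exact h.lintegral_pow_le (k + 2) (by omega)
    _ = ENNReal.ofReal (σ ^ 2 * (((k + 2).choose 2 : ℝ) * (s * Γ) ^ k)) := by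
        rw [← ENNReal.ofReal_mul (by positivity)]
        congr 1
        have := Nat.add_choose_mul_factorial_mul_factorial k 2
        have h' : ((k + 2).factorial : ℝ) = ((k + 2).choose 2) * k.factorial * 2 := by
          rw [← this]
          push_cast [Nat.factorial]
          ring
        rw [h', mul_pow, Nat.add_sub_cancel]
        have : (k.factorial : ℝ) ≠ 0 := by positivity
        field_simp
    _ ≤ _ := by
        gcongr

theorem integrable_sq_mul_exp (h : IsSymmetricBernstein ν σ Γ) (hΓ : 0 ≤ Γ) {s : ℝ}
    (hs : 0 ≤ s) (hsΓ : s * Γ ≤ 1 / 2) : Integrable (fun e => e ^ 2 * Real.exp (s * |e|)) ν := by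
  refine ⟨by fun_prop, ?_⟩
  rw [hasFiniteIntegral_iff_ofReal (ae_of_all _ fun e => by positivity)]
  exact (h.lintegral_sq_mul_exp_le hΓ hs hsΓ).trans_lt ENNReal.ofReal_lt_top

theorem integral_sq_mul_exp_le (h : IsSymmetricBernstein ν σ Γ) (hΓ : 0 ≤ Γ) {s : ℝ}
    (hs : 0 ≤ s) (hsΓ : s * Γ ≤ 1 / 2) : ∫ e, e ^ 2 * Real.exp (s * |e|) ∂ν ≤ 8 * σ ^ 2 := by
  rw [integral_eq_lintegral_of_nonneg_ae (ae_of_all _ fun e => by positivity) (by fun_prop)]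
  exact ENNReal.toReal_le_of_le_ofReal (by positivity) (h.lintegral_sq_mul_exp_le hΓ hs hsΓ)

theorem integrable_sq (h : IsSymmetricBernstein ν σ Γ) : Integrable (fun e => e ^ 2) ν := by
  refine ⟨by fun_prop, ?_⟩
  rw [hasFiniteIntegral_iff_ofReal (ae_of_all _ fun e => by positivity)]
  have := h.lintegral_pow_le 2 le_rfl
  simp only [sq_abs] at this
  exact this.trans_lt ENNReal.ofReal_lt_top

theorem integral_sq_le (h : IsSymmetricBernstein ν σ Γ) : ∫ e, e ^ 2 ∂ν ≤ σ ^ 2 := by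
  rw [integral_eq_lintegral_of_nonneg_ae (ae_of_all _ fun e => by positivity) (by fun_prop)]
  have := h.lintegral_pow_le 2 le_rfl
  simp only [sq_abs] at this
  refine ENNReal.toReal_le_of_le_ofReal (by positivity) (this.trans (le_of_eq ?_))
  norm_num [Nat.factorial]

/-- A nonnegative function is bounded in mean by a bound of its symmetrization. -/
theorem lintegral_le_of_symm (h : IsSymmetricBernstein ν σ Γ) {F U : ℝ → ℝ} (hF : Measurable F)
    (hF0 : ∀ e, 0 ≤ F e) (hU : Integrable U ν) (hle : ∀ e, F e + F (-e) ≤ 2 * U e) :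
    ∫⁻ e, ENNReal.ofReal (F e) ∂ν ≤ ENNReal.ofReal (∫ e, U e ∂ν) := by
  have hU0 : ∀ e, 0 ≤ U e := fun e => by linarith [hF0 e, hF0 (-e), hle e]
  have hneg : ∫⁻ e, ENNReal.ofReal (F (-e)) ∂ν = ∫⁻ e, ENNReal.ofReal (F e) ∂ν := by
    conv_rhs => rw [← h.map_neg]
    rw [lintegral_map (by fun_prop) (by fun_prop)]
  have h2 : 2 * ∫⁻ e, ENNReal.ofReal (F e) ∂ν ≤ 2 * ENNReal.ofReal (∫ e, U e ∂ν) := by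
    rw [ofReal_integral_eq_lintegral_ofReal hU (ae_of_all _ hU0), two_mul]
    nth_rewrite 2 [← hneg]
    rw [← lintegral_add_left (by fun_prop), ← lintegral_const_mul' _ _ (by simp)]
    refine lintegral_mono fun e => ?_
    rw [← ENNReal.ofReal_add (hF0 _) (hF0 _),
      show (2 : ℝ≥0∞) = ENNReal.ofReal 2 by simp, ← ENNReal.ofReal_mul (by norm_num)]
    exact ENNReal.ofReal_le_ofReal (hle e)
  exact (ENNReal.mul_le_mul_iff_right (by simp) (by simp)).1 h2

end IsSymmetricBernstein

/-! ### Likelihood ratios of the surrogate loss -/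

/-- The weight `exp (-u² / Ξ) + a` which an observation with residual `u` contributes to the
surrogate posterior. -/
noncomputable def residualWeight (Ξ a u : ℝ) : ℝ := Real.exp (-(u ^ 2 / Ξ)) + a

theorem residualWeight_pos {Ξ a : ℝ} (ha : 0 ≤ a) (u : ℝ) : 0 < residualWeight Ξ a u := by
  unfold residualWeight
  positivity

@[fun_prop]
theorem measurable_residualWeight (Ξ a : ℝ) : Measurable (residualWeight Ξ a) := by
  unfold residualWeight
  fun_prop

theorem one_sub_exp_neg_le {t : ℝ} (ht : 0 ≤ t) : t - t ^ 2 / 2 ≤ 1 - Real.exp (-t) := by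
  have h := Real.quadratic_le_exp_of_nonneg ht
  have h1 : Real.exp (-t) * Real.exp t = 1 := by rw [← Real.exp_add]; simp
  have h2 := Real.exp_pos (-t)
  have h3 : Real.exp (-t) * (1 + t + t ^ 2 / 2) ≤ 1 := by
    calc _ ≤ Real.exp (-t) * Real.exp t := by gcongr
      _ = 1 := h1
  nlinarith [mul_nonneg h2.le (sq_nonneg t), mul_nonneg (sq_nonneg t) (sq_nonneg t),
    mul_nonneg ht (sq_nonneg t), sq_nonneg (t * (1 + t + t ^ 2 / 2))]

/-- With `g = exp (-e²/Ξ)`, `w = g / (g + a)`, `q = exp (-d²/Ξ)` and `c = cosh (2de/Ξ)`, the left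
side is exactly `2 (1 + w (q c - 1))`. The gain is `w (1 - q)`, of order `d²/Ξ`; the loss `c - 1` is
of order `d² e²/Ξ²`, one power of `Ξ` smaller. -/
theorem residualWeight_ratio_add {Ξ a : ℝ} (hΞ : 0 < Ξ) (ha : 0 ≤ a) (ha1 : a ≤ 1) (d e : ℝ) :
    residualWeight Ξ a (e - d) / residualWeight Ξ a e
        + residualWeight Ξ a (-e - d) / residualWeight Ξ a (-e)
      ≤ 2 * (1 - (d ^ 2 / Ξ - (d ^ 2 / Ξ) ^ 2 / 2) / 2 + d ^ 2 / Ξ / (2 * Ξ) * e ^ 2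
          + (2 * d / Ξ) ^ 2 * (e ^ 2 * Real.exp (|2 * d / Ξ| * |e|))) := by
  set t := d ^ 2 / Ξ with ht
  have ht0 : 0 ≤ t := by positivity
  set g := Real.exp (-(e ^ 2 / Ξ)) with hg
  have hg0 : 0 < g := Real.exp_pos _
  have hg1 : g ≤ 1 := Real.exp_le_one_iff.2 (by simp; positivity)
  have hg2 : 1 - e ^ 2 / Ξ ≤ g := by
    have := Real.add_one_le_exp (-(e ^ 2 / Ξ))
    linarith
  set q := Real.exp (-t) with hq
  have hq0 : 0 < q := Real.exp_pos _
  have hq1 : q ≤ 1 := Real.exp_le_one_iff.2 (by simpa using ht0)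
  have hq2 : 1 - q ≤ t := by
    have := Real.add_one_le_exp (-t)
    linarith
  have hq3 := one_sub_exp_neg_le ht0
  set c := Real.cosh (2 * d / Ξ * e) with hc
  have hc1 : 1 ≤ c := Real.one_le_cosh _
  have hc2 : c - 1 ≤ (2 * d / Ξ) ^ 2 * (e ^ 2 * Real.exp (|2 * d / Ξ| * |e|)) := by
    have := cosh_sub_one_le (2 * d / Ξ * e)
    rw [abs_mul, mul_pow] at this
    linarith
  have hsum : Real.exp (-((e - d) ^ 2 / Ξ)) + Real.exp (-((-e - d) ^ 2 / Ξ)) = 2 * (g * q * c) := by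
    rw [hc, Real.cosh_eq, hg, hq, ht, ← Real.exp_add, mul_div_assoc', mul_add, ← Real.exp_add,
      ← Real.exp_add, mul_div_cancel₀ _ (two_ne_zero)]
    congr 2 <;> field_simp <;> ring
  set w := g / (g + a) with hw
  have hga : 0 < g + a := by positivity
  have hw1 : w ≤ 1 := (div_le_one hga).2 (by linarith)
  have hw0 : 0 ≤ w := by positivity
  -- Here `a ≤ 1` enters: `g + a ≤ 2`, so the gain is diluted by a factor of at most two, uniformly
  -- in `ρ`.
  have hw2 : (1 - e ^ 2 / Ξ) / 2 ≤ w := by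
    rw [hw, le_div_iff₀ hga]
    rcases le_or_gt (1 - e ^ 2 / Ξ) 0 with h | h
    · nlinarith
    · nlinarith
  have hlhs : residualWeight Ξ a (e - d) / residualWeight Ξ a e
      + residualWeight Ξ a (-e - d) / residualWeight Ξ a (-e) = 2 * (1 + w * (q * c - 1)) := by
    have : residualWeight Ξ a (e - d) + residualWeight Ξ a (-e - d) = 2 * (g * q * c) + 2 * a := by
      rw [← hsum]
      unfold residualWeight
      ring
    have h' : residualWeight Ξ a (-e) = g + a := by simp [residualWeight, hg]
    have h'' : residualWeight Ξ a e = g + a := by simp [residualWeight, hg]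
    rw [h', h'', ← add_div, this, hw]
    field_simp
    ring
  rw [hlhs]
  -- From `q c - 1 = q (c - 1) - (1 - q)` and `w q ≤ 1`.
  have h1 : w * (q * c - 1) ≤ (c - 1) - w * (1 - q) := by
    nlinarith [mul_nonneg (sub_nonneg.2 hc1) (sub_nonneg.2 hq1),
      mul_nonneg (sub_nonneg.2 hw1) (sub_nonneg.2 hc1),
      mul_nonneg hw0 (mul_nonneg (sub_nonneg.2 hc1) (sub_nonneg.2 hq1))]
  have h2 : (1 - e ^ 2 / Ξ) / 2 * (1 - q) ≤ w * (1 - q) := by gcongr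
  have h3 : e ^ 2 / Ξ * (1 - q) ≤ e ^ 2 / Ξ * t := by gcongr
  have h4 : t / (2 * Ξ) * e ^ 2 = e ^ 2 / Ξ * t / 2 := by field_simp
  rw [h4]
  linarith

/-- The inverse ratio is `1 / (w exp v + 1 - w)` with `v = 2de/Ξ - d²/Ξ`. Convexity of `exp` bounds
the denominator below by `exp (w v)`, so the additive constant in the weight only shrinks the
exponent. -/
theorem residualWeight_ratio_inv_le {Ξ a : ℝ} (hΞ : 0 < Ξ) (ha : 0 ≤ a) (d e : ℝ) :
    residualWeight Ξ a e / residualWeight Ξ a (e - d) ≤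
      Real.exp (d ^ 2 / Ξ) * Real.exp (-(Real.exp (-(e ^ 2 / Ξ)) / (Real.exp (-(e ^ 2 / Ξ)) + a)
        * (2 * d / Ξ * e))) := by
  set g := Real.exp (-(e ^ 2 / Ξ)) with hg
  have hg0 : 0 < g := Real.exp_pos _
  have hga : 0 < g + a := by positivity
  set w := g / (g + a) with hw
  have hw1 : w ≤ 1 := (div_le_one hga).2 (by linarith)
  have hw0 : 0 ≤ w := by positivity
  set v := 2 * d / Ξ * e - d ^ 2 / Ξ with hv
  have hGv : Real.exp (-((e - d) ^ 2 / Ξ)) = g * Real.exp v := by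
    rw [hg, ← Real.exp_add]
    congr 1
    rw [hv]
    field_simp
    ring
  have hconv : Real.exp (w * v) ≤ w * Real.exp v + (1 - w) := by
    have := convexOn_exp.2 (Set.mem_univ v) (Set.mem_univ 0) hw0 (sub_nonneg.2 hw1) (by ring)
    simpa using this
  have hr : residualWeight Ξ a e / residualWeight Ξ a (e - d) = (w * Real.exp v + (1 - w))⁻¹ := by
    unfold residualWeight
    rw [hGv, ← hg, hw]
    have : g * Real.exp v + a ≠ 0 := by positivity
    have h' : g / (g + a) * Real.exp v + (1 - g / (g + a)) = (g * Real.exp v + a) / (g + a) := by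
      field_simp
      ring
    rw [h', inv_div]
  rw [hr, ← Real.exp_add]
  calc (w * Real.exp v + (1 - w))⁻¹ ≤ (Real.exp (w * v))⁻¹ := by gcongr
    _ = Real.exp (-(w * v)) := (Real.exp_neg _).symm
    _ ≤ _ := by
      gcongr
      rw [hv]
      have : w * (d ^ 2 / Ξ) ≤ 1 * (d ^ 2 / Ξ) := by gcongr
      linarith

/-- The factor `w` depends on `e` only through `e²`, so the exponent in the preceding bound has an
odd part that symmetrizes to a hyperbolic cosine; `w ≤ 1` can then be dropped by monotonicity. -/
theorem residualWeight_ratio_inv_add {Ξ a : ℝ} (hΞ : 0 < Ξ) (ha : 0 ≤ a) (d e : ℝ) :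
    residualWeight Ξ a e / residualWeight Ξ a (e - d)
        + residualWeight Ξ a (-e) / residualWeight Ξ a (-e - d)
      ≤ 2 * (Real.exp (d ^ 2 / Ξ) *
          (1 + (2 * d / Ξ) ^ 2 * (e ^ 2 * Real.exp (|2 * d / Ξ| * |e|)))) := by
  have h1 := residualWeight_ratio_inv_le hΞ ha d e
  have h2 := residualWeight_ratio_inv_le hΞ ha d (-e)
  rw [neg_sq, mul_neg, mul_neg, neg_neg] at h2
  set w := Real.exp (-(e ^ 2 / Ξ)) / (Real.exp (-(e ^ 2 / Ξ)) + a) with hw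
  have hw1 : w ≤ 1 := (div_le_one (by positivity)).2 (by linarith)
  have hw0 : 0 ≤ w := by positivity
  have hcosh := cosh_sub_one_le (2 * d / Ξ * e)
  rw [abs_mul, mul_pow] at hcosh
  have hmono : Real.cosh (w * (2 * d / Ξ * e)) ≤ Real.cosh (2 * d / Ξ * e) := by
    rw [Real.cosh_le_cosh, abs_mul, abs_of_nonneg hw0]
    exact mul_le_of_le_one_left (abs_nonneg _) hw1
  have hexp := Real.exp_pos (d ^ 2 / Ξ)
  calc _ ≤ Real.exp (d ^ 2 / Ξ) * (2 * Real.cosh (w * (2 * d / Ξ * e))) := by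
        rw [Real.cosh_eq]
        linarith
    _ ≤ Real.exp (d ^ 2 / Ξ) *
          (2 * (1 + (2 * d / Ξ) ^ 2 * (e ^ 2 * Real.exp (|2 * d / Ξ| * |e|)))) := by
        gcongr
        linarith
    _ = _ := by ring

/-- The temperature is large compared to the bound `C` and the noise parameters. -/
structure IsTemperature (C σ Γ Ξ : ℝ) : Prop where
  le : 8 * C * Γ + 32 * C ^ 2 + 256 * σ ^ 2 ≤ Ξ
  C_pos : 0 < C
  Γ_pos : 0 < Γ

namespace IsTemperature

variable {C σ Γ Ξ : ℝ}

theorem pos (h : IsTemperature C σ Γ Ξ) : 0 < Ξ := by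
  have h1 := h.C_pos
  have h2 := h.Γ_pos
  exact lt_of_lt_of_le (by positivity) h.le

/-- The summands in the lower bound on `Ξ` serve one estimate each: `8CΓ` makes the exponential
moment of the noise finite, `32C²` makes `d²/Ξ` small, and `256σ²` makes the `cosh` loss a small
fraction of `d²/Ξ`. -/
theorem scale_le (h : IsTemperature C σ Γ Ξ) {d : ℝ} (hd : |d| ≤ 2 * C) :
    |2 * d / Ξ| * Γ ≤ 1 / 2 := by
  have h0 := h.pos
  have h1 := h.Γ_pos
  rw [abs_div, abs_mul, abs_of_pos h0, abs_two, div_mul_eq_mul_div, div_le_iff₀ h0]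
  have h2 : |d| * Γ ≤ 2 * C * Γ := by gcongr
  nlinarith [h.le, sq_nonneg C, sq_nonneg σ]

theorem sq_div_le (h : IsTemperature C σ Γ Ξ) {d : ℝ} (hd : |d| ≤ 2 * C) :
    d ^ 2 / Ξ ≤ 1 / 8 := by
  rw [div_le_iff₀ h.pos]
  have h2 : d ^ 2 ≤ (2 * C) ^ 2 := sq_le_sq' (abs_le.1 hd).1 (abs_le.1 hd).2
  nlinarith [h.le, sq_nonneg σ, mul_pos h.C_pos h.Γ_pos]

theorem variance_div_le (h : IsTemperature C σ Γ Ξ) : σ ^ 2 / Ξ ≤ 1 / 256 := by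
  rw [div_le_iff₀ h.pos]
  nlinarith [h.le, sq_nonneg C, mul_pos h.C_pos h.Γ_pos]

end IsTemperature

/-! ### Mean likelihood ratios under symmetric noise -/

section Ratio

variable {ν : Measure ℝ} [IsProbabilityMeasure ν] {C σ Γ Ξ a d : ℝ}

/-- In units of `t = d²/Ξ`, the gain `t/2` loses `t²/4 ≤ t/32`, at most `t/512` from the variance
and at most `t/8` from the hyperbolic cosine, so more than `t/4` remains. -/
theorem IsSymmetricBernstein.lintegral_ratio_le (h : IsSymmetricBernstein ν σ Γ)
    (hΞ : IsTemperature C σ Γ Ξ) (ha : 0 ≤ a) (ha1 : a ≤ 1) (hd : |d| ≤ 2 * C) :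
    ∫⁻ e, ENNReal.ofReal (residualWeight Ξ a (e - d) / residualWeight Ξ a e) ∂ν
      ≤ ENNReal.ofReal (1 - d ^ 2 / (4 * Ξ)) := by
  have hs := hΞ.scale_le hd
  have i1 := h.integrable_sq_mul_exp hΞ.Γ_pos.le (abs_nonneg _) hs
  have i2 := h.integral_sq_mul_exp_le hΞ.Γ_pos.le (abs_nonneg _) hs
  have hΞ0 := hΞ.pos
  refine (h.lintegral_le_of_symm (by fun_prop) (fun e => ?_)
    (((integrable_const _).add (h.integrable_sq.const_mul _)).add (i1.const_mul _))
    (fun e => residualWeight_ratio_add hΞ0 ha ha1 d e)).trans (ENNReal.ofReal_le_ofReal ?_)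
  · exact div_nonneg (residualWeight_pos ha _).le (residualWeight_pos ha _).le
  · rw [integral_add' ((integrable_const _).add (h.integrable_sq.const_mul _)) (i1.const_mul _),
      integral_add' (integrable_const _) (h.integrable_sq.const_mul _), integral_const_mul,
      integral_const_mul, integral_const, probReal_univ, one_smul]
    set t := d ^ 2 / Ξ with ht
    have ht0 : 0 ≤ t := by positivity
    have ht1 := hΞ.sq_div_le hd
    have hσ := hΞ.variance_div_le
    have e1 : t / (2 * Ξ) * ∫ e, e ^ 2 ∂ν ≤ t / (2 * Ξ) * σ ^ 2 := by
      gcongr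
      exact h.integral_sq_le
    have e2 : (2 * d / Ξ) ^ 2 * ∫ e, e ^ 2 * Real.exp (|2 * d / Ξ| * |e|) ∂ν
        ≤ (2 * d / Ξ) ^ 2 * (8 * σ ^ 2) := by gcongr
    have e3 : t / (2 * Ξ) * σ ^ 2 = t * (σ ^ 2 / Ξ) / 2 := by field_simp
    have e4 : (2 * d / Ξ) ^ 2 * (8 * σ ^ 2) = 32 * (t * (σ ^ 2 / Ξ)) := by rw [ht]; field_simp; ring
    have e5 : d ^ 2 / (4 * Ξ) = t / 4 := by rw [ht]; field_simp
    have e6 : t * (σ ^ 2 / Ξ) ≤ t * (1 / 256) := by gcongr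
    have e7 : t * t ≤ t * (1 / 8) := by gcongr
    rw [e5]
    nlinarith

theorem IsSymmetricBernstein.lintegral_ratio_inv_le (h : IsSymmetricBernstein ν σ Γ)
    (hΞ : IsTemperature C σ Γ Ξ) (ha : 0 ≤ a) (hd : |d| ≤ 2 * C) :
    ∫⁻ e, ENNReal.ofReal (residualWeight Ξ a e / residualWeight Ξ a (e - d)) ∂ν
      ≤ ENNReal.ofReal (1 + 3 * d ^ 2 / (2 * Ξ)) := by
  have hs := hΞ.scale_le hd
  have i1 := h.integrable_sq_mul_exp hΞ.Γ_pos.le (abs_nonneg _) hs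
  have i2 := h.integral_sq_mul_exp_le hΞ.Γ_pos.le (abs_nonneg _) hs
  have hΞ0 := hΞ.pos
  refine (h.lintegral_le_of_symm (by fun_prop) (fun e => ?_)
    (((integrable_const 1).add (i1.const_mul _)).const_mul _)
    (fun e => residualWeight_ratio_inv_add hΞ0 ha d e)).trans (ENNReal.ofReal_le_ofReal ?_)
  · exact div_nonneg (residualWeight_pos ha _).le (residualWeight_pos ha _).le
  · rw [integral_const_mul, integral_add' (integrable_const _) (i1.const_mul _), integral_const_mul,
      integral_const, probReal_univ, one_smul]
    set t := d ^ 2 / Ξ with ht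
    have ht0 : 0 ≤ t := by positivity
    have ht1 := hΞ.sq_div_le hd
    have hσ := hΞ.variance_div_le
    have e2 : (2 * d / Ξ) ^ 2 * ∫ e, e ^ 2 * Real.exp (|2 * d / Ξ| * |e|) ∂ν
        ≤ (2 * d / Ξ) ^ 2 * (8 * σ ^ 2) := by gcongr
    have e4 : (2 * d / Ξ) ^ 2 * (8 * σ ^ 2) = 32 * (t * (σ ^ 2 / Ξ)) := by rw [ht]; field_simp; ring
    have e5 : 3 * d ^ 2 / (2 * Ξ) = 3 / 2 * t := by rw [ht]; field_simp
    have e6 : t * (σ ^ 2 / Ξ) ≤ t * (1 / 256) := by gcongr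
    have e8 : Real.exp t ≤ 1 + t + t ^ 2 := by
      have := Real.abs_exp_sub_one_sub_id_le (x := t) (by rw [abs_of_nonneg ht0]; linarith)
      linarith [(abs_le.1 this).2]
    rw [e5]
    calc _ ≤ (1 + t + t ^ 2) * (1 + t / 8) := by
          have : (0 : ℝ) ≤ ∫ e, e ^ 2 * Real.exp (|2 * d / Ξ| * |e|) ∂ν :=
            integral_nonneg fun e => by positivity
          refine mul_le_mul e8 (by linarith) (by positivity) (by positivity)
      _ ≤ 1 + 3 / 2 * t := by
          have e7 : t * t ≤ t * (1 / 8) := by gcongr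
          have e9 : t * t * t ≤ t * (1 / 8) * t := by gcongr
          nlinarith

end Ratio

/-! ### Consequences of the model for a single observation -/

/-- The squared `L²(μ)`-distance. -/
noncomputable def sqDist {E : Type*} [MeasurableSpace E] (μ : Measure E) (f h : E → ℝ) : ℝ :=
  ∫ x, (h x - f x) ^ 2 ∂μ

theorem sqDist_nonneg {E : Type*} [MeasurableSpace E] (μ : Measure E) (f h : E → ℝ) :
    0 ≤ sqDist μ f h := integral_nonneg fun _ => sq_nonneg _

theorem integrable_sq_sub {E : Type*} [MeasurableSpace E] {μ : Measure E} [IsFiniteMeasure μ]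
    {f h : E → ℝ} {C : ℝ} (hf : Measurable f) (hh : Measurable h) (hfC : ∀ᵐ x ∂μ, |f x| ≤ C)
    (hhC : ∀ᵐ x ∂μ, |h x| ≤ C) : Integrable (fun x => (h x - f x) ^ 2) μ := by
  refine Integrable.of_bound (by fun_prop) ((2 * C) ^ 2) ?_
  filter_upwards [hfC, hhC] with x h1 h2
  rw [Real.norm_eq_abs, abs_of_nonneg (sq_nonneg _)]
  rw [abs_le] at h1 h2
  exact sq_le_sq' (by linarith) (by linarith)

namespace IsBoundedRegression

variable {Ω : Type*} [MeasurableSpace Ω] {p : ℕ} {P : Measure Ω} [IsProbabilityMeasure P]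
  {X : Ω → EuclideanSpace ℝ (Fin p)} {Y : Ω → ℝ} {f h : EuclideanSpace ℝ (Fin p) → ℝ}
  {C K σ Γ Ξ a : ℝ}

theorem measurable_noise (H : IsBoundedRegression P X Y f C K σ Γ) :
    Measurable (fun ω => Y ω - f (X ω)) :=
  H.measurable_Y.sub (H.measurable_f.comp H.measurable_X)

theorem isProbabilityMeasure_map (H : IsBoundedRegression P X Y f C K σ Γ) :
    IsProbabilityMeasure (P.map X) :=
  Measure.isProbabilityMeasure_map H.measurable_X.aemeasurable

/-- Conditional expectations become integrals against the regular conditional distribution. As there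
are only countably many exponents `k`, one null set serves all of them. -/
theorem ae_isSymmetricBernstein (H : IsBoundedRegression P X Y f C K σ Γ) :
    ∀ᵐ x ∂(P.map X),
      IsSymmetricBernstein (condDistrib (fun ω => Y ω - f (X ω)) X P x) σ Γ := by
  have hmom : ∀ k : ℕ, 2 ≤ k → ∀ᵐ x ∂(P.map X),
      ∫⁻ e, ENNReal.ofReal (|e| ^ k) ∂(condDistrib (fun ω => Y ω - f (X ω)) X P x)
        ≤ ENNReal.ofReal (k.factorial / 2 * σ ^ 2 * Γ ^ (k - 2)) := by
    intro k hk
    have hmeas : Measurable fun x =>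
        ∫⁻ e, ENNReal.ofReal (|e| ^ k) ∂(condDistrib (fun ω => Y ω - f (X ω)) X P x) :=
      Measurable.lintegral_kernel (by fun_prop)
    rw [ae_map_iff H.measurable_X.aemeasurable (measurableSet_le hmeas measurable_const)]
    have hint : Integrable (fun z : EuclideanSpace ℝ (Fin p) × ℝ => |z.2| ^ k)
        (P.map fun ω => (X ω, Y ω - f (X ω))) := by
      rw [integrable_map_measure (by fun_prop) (H.measurable_X.prodMk H.measurable_noise).aemeasurable]
      exact H.integrable_moments k hk
    filter_upwards [H.conditional_moments k hk,
      condExp_ae_eq_integral_condDistrib H.measurable_X H.measurable_noise.aemeasurable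
        (f := fun e : ℝ => |e| ^ k) (by fun_prop) (H.integrable_moments k hk),
      hint.condDistrib_ae H.measurable_X.aemeasurable H.measurable_noise.aemeasurable]
      with ω h1 h2 h3
    rw [h2] at h1
    rw [← ofReal_integral_eq_lintegral_ofReal h3 (ae_of_all _ fun e => by positivity)]
    exact ENNReal.ofReal_le_ofReal h1
  have hmom' : ∀ᵐ x ∂(P.map X), ∀ k : ℕ, 2 ≤ k →
      ∫⁻ e, ENNReal.ofReal (|e| ^ k) ∂(condDistrib (fun ω => Y ω - f (X ω)) X P x)
        ≤ ENNReal.ofReal (k.factorial / 2 * σ ^ 2 * Γ ^ (k - 2)) := by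
    rw [ae_all_iff]
    intro k
    by_cases hk : 2 ≤ k
    · filter_upwards [hmom k hk] with x hx _ using hx
    · exact ae_of_all _ fun x h => absurd h hk
  filter_upwards [hmom', H.conditional_symmetry] with x h1 h2
  exact ⟨h2, h1⟩

theorem lintegral_observation (H : IsBoundedRegression P X Y f C K σ Γ)
    {F : EuclideanSpace ℝ (Fin p) × ℝ → ℝ≥0∞} (hF : Measurable F) :
    ∫⁻ z, F z ∂(P.map fun ω => (X ω, Y ω)) =
      ∫⁻ x, ∫⁻ e, F (x, f x + e) ∂(condDistrib (fun ω => Y ω - f (X ω)) X P x) ∂(P.map X) := by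
  have hf := H.measurable_f
  have hF' : Measurable fun z : EuclideanSpace ℝ (Fin p) × ℝ => F (z.1, f z.1 + z.2) := by
    fun_prop
  rw [← Measure.lintegral_compProd hF', compProd_map_condDistrib H.measurable_noise.aemeasurable,
    lintegral_map hF' (H.measurable_X.prodMk H.measurable_noise),
    lintegral_map hF (H.measurable_X.prodMk H.measurable_Y)]
  simp

/-- The exponential moment of the surrogate loss difference. -/
theorem lintegral_ratio_le (H : IsBoundedRegression P X Y f C K σ Γ)
    (hΞ : IsTemperature C σ Γ Ξ) (ha : 0 ≤ a) (ha1 : a ≤ 1) (hh : Measurable h)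
    (hhC : ∀ x, |h x| ≤ C) :
    ∫⁻ z, ENNReal.ofReal (residualWeight Ξ a (z.2 - h z.1) / residualWeight Ξ a (z.2 - f z.1))
        ∂(P.map fun ω => (X ω, Y ω))
      ≤ ENNReal.ofReal (Real.exp (-(sqDist (P.map X) f h / (4 * Ξ)))) := by
  have hf := H.measurable_f
  have := H.isProbabilityMeasure_map
  have hint := integrable_sq_sub hf hh H.bounded (ae_of_all _ hhC)
  rw [H.lintegral_observation (by fun_prop)]
  have hpos : ∀ᵐ x ∂(P.map X), 0 ≤ 1 - (h x - f x) ^ 2 / (4 * Ξ) := by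
    filter_upwards [H.bounded] with x hx
    have h1 := hΞ.sq_div_le (d := h x - f x) ((abs_sub _ _).trans (by linarith [hhC x]))
    have h2 : (h x - f x) ^ 2 / (4 * Ξ) = (h x - f x) ^ 2 / Ξ / 4 := by
      have := hΞ.pos
      field_simp
    linarith
  calc _ ≤ ∫⁻ x, ENNReal.ofReal (1 - (h x - f x) ^ 2 / (4 * Ξ)) ∂(P.map X) := by
        refine lintegral_mono_ae ?_
        filter_upwards [H.ae_isSymmetricBernstein, H.bounded] with x hx hfx
        refine le_trans (lintegral_mono fun e => ENNReal.ofReal_le_ofReal (le_of_eq ?_))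
          (hx.lintegral_ratio_le hΞ ha ha1 (d := h x - f x)
            ((abs_sub _ _).trans (by linarith [hhC x])))
        congr 2 <;> ring_nf
    _ = ENNReal.ofReal (1 - sqDist (P.map X) f h / (4 * Ξ)) := by
        have hi : Integrable (fun x => 1 - (h x - f x) ^ 2 / (4 * Ξ)) (P.map X) :=
          (integrable_const _).sub (hint.div_const _)
        rw [← ofReal_integral_eq_lintegral_ofReal hi hpos,
          integral_sub (integrable_const _) (hint.div_const _), integral_div]
        simp [sqDist]
    _ ≤ _ := by
        refine ENNReal.ofReal_le_ofReal ?_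
        linarith [Real.add_one_le_exp (-(sqDist (P.map X) f h / (4 * Ξ)))]

theorem lintegral_ratio_inv_le (H : IsBoundedRegression P X Y f C K σ Γ)
    (hΞ : IsTemperature C σ Γ Ξ) (ha : 0 ≤ a) (hh : Measurable h) (hhC : ∀ x, |h x| ≤ C) :
    ∫⁻ z, ENNReal.ofReal (residualWeight Ξ a (z.2 - f z.1) / residualWeight Ξ a (z.2 - h z.1))
        ∂(P.map fun ω => (X ω, Y ω))
      ≤ ENNReal.ofReal (Real.exp (3 * sqDist (P.map X) f h / (2 * Ξ))) := by
  have hf := H.measurable_f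
  have := H.isProbabilityMeasure_map
  have hint := integrable_sq_sub hf hh H.bounded (ae_of_all _ hhC)
  have hΞ0 := hΞ.pos
  rw [H.lintegral_observation (by fun_prop)]
  calc _ ≤ ∫⁻ x, ENNReal.ofReal (1 + 3 * (h x - f x) ^ 2 / (2 * Ξ)) ∂(P.map X) := by
        refine lintegral_mono_ae ?_
        filter_upwards [H.ae_isSymmetricBernstein, H.bounded] with x hx hfx
        refine le_trans (lintegral_mono fun e => ENNReal.ofReal_le_ofReal (le_of_eq ?_))
          (hx.lintegral_ratio_inv_le hΞ ha (d := h x - f x)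
            ((abs_sub _ _).trans (by linarith [hhC x])))
        congr 2 <;> ring_nf
    _ = ENNReal.ofReal (1 + 3 * sqDist (P.map X) f h / (2 * Ξ)) := by
        have hi : Integrable (fun x => 1 + 3 * (h x - f x) ^ 2 / (2 * Ξ)) (P.map X) :=
          (integrable_const _).add ((hint.const_mul 3).div_const _)
        rw [← ofReal_integral_eq_lintegral_ofReal hi (ae_of_all _ fun x => by positivity),
          integral_add (integrable_const _) ((hint.const_mul 3).div_const _), integral_div,
          integral_const_mul]
        simp [sqDist]
    _ ≤ _ := by
        refine ENNReal.ofReal_le_ofReal ?_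
        linarith [Real.add_one_le_exp (3 * sqDist (P.map X) f h / (2 * Ξ))]

/-- The excess risk is the squared `L²`-distance to the regression function. -/
theorem excessRisk_eq (H : IsBoundedRegression P X Y f C K σ Γ) (hh : Measurable h)
    (hhC : ∀ x, |h x| ≤ C) : excessRisk P X Y f h = sqDist (P.map X) f h := by
  have hf := H.measurable_f
  have hX := H.measurable_X
  have := H.isProbabilityMeasure_map
  have hint := integrable_sq_sub hf hh H.bounded (ae_of_all _ hhC)
  have hint' : Integrable (fun ω => (h (X ω) - f (X ω)) ^ 2) P := by
    rwa [integrable_map_measure (by fun_prop) hX.aemeasurable] at hint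
  have hbd : ∀ᵐ ω ∂P, ‖h (X ω) - f (X ω)‖ ≤ C + C := by
    filter_upwards [ae_of_ae_map hX.aemeasurable H.bounded] with ω hω
    exact (abs_sub _ _).trans (add_le_add (hhC _) hω)
  have hmul : Integrable (fun ω => (h (X ω) - f (X ω)) * (Y ω - f (X ω))) P :=
    H.integrable_noise.bdd_mul (by fun_prop) hbd
  have hcross : ∫ ω, (h (X ω) - f (X ω)) * (Y ω - f (X ω)) ∂P = 0 := by
    rw [← integral_condExp hX.comap_le]
    have hsm : StronglyMeasurable[MeasurableSpace.comap X inferInstance]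
        fun ω => h (X ω) - f (X ω) :=
      ((hh.sub hf).comp (comap_measurable X)).stronglyMeasurable
    rw [integral_congr_ae (g := 0), Pi.zero_def, integral_zero]
    filter_upwards [condExp_mul_of_stronglyMeasurable_left hsm hmul H.integrable_noise,
      H.condExp_noise] with ω h1 h2
    refine h1.trans ?_
    rw [Pi.mul_apply, h2, Pi.zero_apply, mul_zero]
  have hnoise : Integrable (fun ω => (Y ω - f (X ω)) ^ 2) P := by
    simpa using H.integrable_moments 2 le_rfl
  have hexp : ∀ ω, (Y ω - h (X ω)) ^ 2 = (Y ω - f (X ω)) ^ 2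
      + ((h (X ω) - f (X ω)) ^ 2 - 2 * ((h (X ω) - f (X ω)) * (Y ω - f (X ω)))) := fun ω => by ring
  have hi : Integrable (fun ω => (h (X ω) - f (X ω)) ^ 2
      - 2 * ((h (X ω) - f (X ω)) * (Y ω - f (X ω)))) P := hint'.sub (hmul.const_mul 2)
  unfold excessRisk risk sqDist
  simp_rw [hexp]
  rw [integral_add hnoise hi, integral_sub hint' (hmul.const_mul 2),
    integral_const_mul, hcross, integral_map hX.aemeasurable (by fun_prop)]
  ring

end IsBoundedRegression

/-! ### A PAC-Bayes bound for product likelihoods -/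

theorem exp_sum_log_likelihood {T Z : Type*} {n : ℕ} {w : T → Z → ℝ} (hw0 : ∀ θ z, 0 < w θ z) (d : Fin n → Z) (θ : T) :
    Real.exp (∑ i, Real.log (w θ (d i))) = ∏ i, w θ (d i) := by
  rw [Real.exp_sum]
  exact Finset.prod_congr rfl fun i _ => Real.exp_log (hw0 θ (d i))

section PACBayes

variable {T Z : Type*} [MeasurableSpace T] [MeasurableSpace Z]

theorem lintegral_pi_prod {n : ℕ} (Q : Measure Z) [IsProbabilityMeasure Q] {g : Z → ℝ≥0∞}
    (hg : Measurable g) :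
    ∫⁻ d, ∏ i, g (d i) ∂(Measure.pi fun _ : Fin n => Q) = (∫⁻ z, g z ∂Q) ^ n := by
  have hind : iIndepFun (fun (i : Fin n) (d : Fin n → Z) => g (d i))
      (Measure.pi fun _ : Fin n => Q) := iIndepFun_pi (X := fun _ => g) fun _ => hg.aemeasurable
  rw [lintegral_prod_eq_prod_lintegral_of_indepFun Finset.univ _ hind (fun i => by fun_prop)]
  have : ∀ i : Fin n, ∫⁻ d, g (d i) ∂(Measure.pi fun _ : Fin n => Q) = ∫⁻ z, g z ∂Q :=
    fun i => (measurePreserving_eval (fun _ : Fin n => Q) i).lintegral_comp hg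
  simp [this]

/-- The posterior with likelihood `∏ i, w θ (d i)`. -/
noncomputable def likelihoodPosterior {n : ℕ} (π : Measure T) (w : T → Z → ℝ) (d : Fin n → Z) :
    Measure T :=
  π.tilted fun θ => ∑ i, Real.log (w θ (d i))

/-- A lower bound for a normalizing constant by the mean of the inverse density. -/
theorem sq_div_le_integral {π : Measure T} {h : T → ℝ} (hh0 : ∀ θ, 0 < h θ) (hi : Integrable h π) {S : Set T}
    {m A : ℝ} (hm : 0 < m) (hA : 0 < A) (hS : π S = ENNReal.ofReal m)
    (hle : ∫⁻ θ in S, ENNReal.ofReal (h θ)⁻¹ ∂π ≤ ENNReal.ofReal A) :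
    m ^ 2 / A ≤ ∫ θ, h θ ∂π := by
  set t := A / m with ht
  have ht0 : 0 < t := by positivity
  have hint0 : 0 ≤ ∫ θ, h θ ∂π := integral_nonneg fun θ => (hh0 θ).le
  -- Cauchy–Schwarz in its additive form `2 ≤ x + 1/x` with `x = t h`. Integrating over `S` with `t
  -- = A/m` makes the inverse term at most `m`, which leaves `m ≤ (A/m) ∫ h`.
  have hpt : ∀ θ, (2 : ℝ≥0∞) ≤ ENNReal.ofReal (t * h θ)
      + ENNReal.ofReal t⁻¹ * ENNReal.ofReal (h θ)⁻¹ := fun θ => by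
    have hx : 0 < t * h θ := mul_pos ht0 (hh0 θ)
    have hh := (hh0 θ).ne'
    rw [← ENNReal.ofReal_mul (by positivity), ← mul_inv, ← ENNReal.ofReal_add hx.le (by positivity),
      show (2 : ℝ≥0∞) = ENNReal.ofReal 2 by simp]
    refine ENNReal.ofReal_le_ofReal ?_
    have := sq_nonneg (t * h θ - 1)
    rw [← sub_nonneg, show t * h θ + (t * h θ)⁻¹ - 2 = (t * h θ - 1) ^ 2 / (t * h θ) by
      have := hx.ne'
      field_simp
      ring]
    positivity
  have h1 : 2 * ENNReal.ofReal m ≤ ENNReal.ofReal (t * ∫ θ, h θ ∂π + m) := by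
    calc 2 * ENNReal.ofReal m = ∫⁻ _ in S, 2 ∂π := by simp [hS]
      _ ≤ ∫⁻ θ in S, (ENNReal.ofReal (t * h θ)
          + ENNReal.ofReal t⁻¹ * ENNReal.ofReal (h θ)⁻¹) ∂π := lintegral_mono hpt
      _ = ∫⁻ θ in S, ENNReal.ofReal (t * h θ) ∂π
          + ENNReal.ofReal t⁻¹ * ∫⁻ θ in S, ENNReal.ofReal (h θ)⁻¹ ∂π := by
          rw [lintegral_add_left' (hi.const_mul t).1.aemeasurable.ennreal_ofReal.restrict,
            lintegral_const_mul' _ _ ENNReal.ofReal_ne_top]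
      _ ≤ ∫⁻ θ, ENNReal.ofReal (t * h θ) ∂π + ENNReal.ofReal t⁻¹ * ENNReal.ofReal A := by
          gcongr
          exact Measure.restrict_le_self
      _ = _ := by
          rw [← ofReal_integral_eq_lintegral_ofReal (hi.const_mul t)
            (ae_of_all _ fun θ => (mul_pos ht0 (hh0 θ)).le), integral_const_mul,
            ← ENNReal.ofReal_mul (by positivity), ← ENNReal.ofReal_add (by positivity)
            (by positivity)]
          congr 2
          rw [ht]
          field_simp
  rw [show (2 : ℝ≥0∞) = ENNReal.ofReal 2 by simp, ← ENNReal.ofReal_mul (by norm_num),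
    ENNReal.ofReal_le_ofReal_iff (by positivity), ht] at h1
  rw [div_le_iff₀ hA]
  have h2 : m ≤ A / m * ∫ θ, h θ ∂π := by linarith
  rw [div_mul_eq_mul_div, le_div_iff₀ hm] at h2
  linarith

section Bound

variable {n : ℕ} {π : Measure T} [IsProbabilityMeasure π] {w : T → Z → ℝ} {r : Z → ℝ} {M : ℝ}

theorem integrable_likelihood (hw : Measurable (Function.uncurry w)) (hw0 : ∀ θ z, 0 < w θ z)
    (hwM : ∀ θ z, w θ z ≤ M) (d : Fin n → Z) : Integrable (fun θ => ∏ i, w θ (d i)) π := by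
  refine Integrable.of_bound (C := M ^ n) ?_ (ae_of_all _ fun θ => ?_)
  · have : Measurable fun θ => ∏ i, w θ (d i) :=
      Finset.measurable_prod _ fun i _ => hw.comp (measurable_id.prodMk measurable_const)
    exact this.aestronglyMeasurable
  · rw [Real.norm_eq_abs, abs_of_pos (Finset.prod_pos fun i _ => hw0 θ (d i))]
    calc ∏ i, w θ (d i) ≤ ∏ _i : Fin n, M :=
          Finset.prod_le_prod (fun i _ => (hw0 θ (d i)).le) fun i _ => hwM θ (d i)
      _ = M ^ n := by simp

theorem isProbabilityMeasure_likelihoodPosterior (hw : Measurable (Function.uncurry w))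
    (hw0 : ∀ θ z, 0 < w θ z) (hwM : ∀ θ z, w θ z ≤ M) (d : Fin n → Z) :
    IsProbabilityMeasure (likelihoodPosterior π w d) := by
  refine isProbabilityMeasure_tilted ?_
  simp_rw [exp_sum_log_likelihood hw0]
  exact integrable_likelihood hw hw0 hwM d

/-- Dividing numerator and normalizing constant by the reference likelihood `∏ r (d i)` does not
change the posterior, and `sq_div_le_integral` bounds the normalized constant below by `m² / A`. -/
theorem lintegral_likelihoodPosterior_le (hw : Measurable (Function.uncurry w))
    (hw0 : ∀ θ z, 0 < w θ z) (hwM : ∀ θ z, w θ z ≤ M) (hr0 : ∀ z, 0 < r z) {S : Set T}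
    {m A : ℝ} (hm : 0 < m) (hA : 0 < A) (hS : π S = ENNReal.ofReal m) (d : Fin n → Z)
    (hle : ∫⁻ θ in S, ∏ i, ENNReal.ofReal (r (d i) / w θ (d i)) ∂π ≤ ENNReal.ofReal A)
    (k : T → ℝ≥0∞) :
    ∫⁻ θ, k θ ∂(likelihoodPosterior π w d)
      ≤ ENNReal.ofReal (A / m ^ 2)
        * ∫⁻ θ, k θ * ∏ i, ENNReal.ofReal (w θ (d i) / r (d i)) ∂π := by
  set c := ∏ i, r (d i) with hc
  have hc0 : 0 < c := Finset.prod_pos fun i _ => hr0 (d i)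
  have hH := integrable_likelihood (π := π) hw hw0 hwM d
  have hH0 : ∀ θ, 0 < ∏ i, w θ (d i) := fun θ => Finset.prod_pos fun i _ => hw0 θ (d i)
  have hZ := sq_div_le_integral (π := π) (h := fun θ => (∏ i, w θ (d i)) / c) (S := S)
    (fun θ => div_pos (hH0 θ) hc0) (hH.div_const c) hm hA hS (by
      refine le_trans (le_of_eq (lintegral_congr fun θ => ?_)) hle
      rw [inv_div, hc, ← Finset.prod_div_distrib,
        ENNReal.ofReal_prod_of_nonneg fun i _ => (div_pos (hr0 _) (hw0 _ _)).le])
  rw [integral_div] at hZ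
  have hZ0 : 0 < ∫ θ, ∏ i, w θ (d i) ∂π := by
    have : 0 < (∫ θ, ∏ i, w θ (d i) ∂π) / c := lt_of_lt_of_le (by positivity) hZ
    exact (div_pos_iff_of_pos_right hc0).1 this
  unfold likelihoodPosterior
  rw [lintegral_tilted]
  simp_rw [exp_sum_log_likelihood hw0]
  rw [← lintegral_const_mul' _ _ ENNReal.ofReal_ne_top]
  refine lintegral_mono fun θ => ?_
  rw [mul_left_comm, mul_comm (k θ)]
  gcongr
  rw [← ENNReal.ofReal_prod_of_nonneg fun i _ => (div_pos (hw0 _ _) (hr0 _)).le,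
    Finset.prod_div_distrib, ← hc, ← ENNReal.ofReal_mul (by positivity)]
  refine ENNReal.ofReal_le_ofReal ?_
  have h0 := hH0 θ
  set q := ∏ i, w θ (d i)
  set I := ∫ θ, ∏ i, w θ (d i) ∂π
  rw [div_le_div_iff₀ hA hc0] at hZ
  rw [div_mul_div_comm, div_le_div_iff₀ hZ0 (by positivity)]
  nlinarith [mul_le_mul_of_nonneg_left hZ h0.le]

/-- With probability at least `1 - δ`, the posterior mean of `k` is bounded in terms of the
prior mean of `k * exp (-n b s)`, where `b s` and `c s` control the exponential moments of a single
observation. -/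
theorem exists_event_lintegral_posterior_le (Q : Measure Z) [IsProbabilityMeasure Q]
    (hw : Measurable (Function.uncurry w)) (hw0 : ∀ θ z, 0 < w θ z) (hwM : ∀ θ z, w θ z ≤ M)
    (hr : Measurable r) (hr0 : ∀ z, 0 < r z) {s : T → ℝ} {b c V : ℝ} (hc : 0 ≤ c)
    (hlow : ∀ θ, ∫⁻ z, ENNReal.ofReal (w θ z / r z) ∂Q ≤ ENNReal.ofReal (Real.exp (-(b * s θ))))
    (hup : ∀ θ, ∫⁻ z, ENNReal.ofReal (r z / w θ z) ∂Q ≤ ENNReal.ofReal (Real.exp (c * s θ)))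
    {S : Set T} (hSm : MeasurableSet S) {m : ℝ} (hm : 0 < m) (hS : π S = ENNReal.ofReal m)
    (hV : ∀ θ ∈ S, s θ ≤ V) {k : T → ℝ≥0∞} (hk : Measurable k) {J : ℝ} (hJ : 0 < J)
    (hkJ : ∫⁻ θ, k θ * ENNReal.ofReal (Real.exp (-(n * (b * s θ)))) ∂π ≤ ENNReal.ofReal J)
    {δ : ℝ} (hδ : 0 < δ) :
    ∃ G : Set (Fin n → Z), MeasurableSet G ∧
      ENNReal.ofReal (1 - δ) ≤ (Measure.pi fun _ : Fin n => Q) G ∧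
      ∀ d ∈ G, ∫⁻ θ, k θ ∂(likelihoodPosterior π w d)
        ≤ ENNReal.ofReal (4 / δ ^ 2 * Real.exp (n * (c * V)) * J / m) := by
  set ν := Measure.pi fun _ : Fin n => Q with hν
  have hratio : Measurable fun x : (Fin n → Z) × T =>
      ∏ i, ENNReal.ofReal (w x.2 (x.1 i) / r (x.1 i)) :=
    Finset.measurable_prod _ fun i _ => by
      have h1 : Measurable fun x : (Fin n → Z) × T => w x.2 (x.1 i) :=
        hw.comp (measurable_snd.prodMk ((measurable_pi_apply i).comp measurable_fst))
      fun_prop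
  have hratio' : Measurable fun x : (Fin n → Z) × T =>
      ∏ i, ENNReal.ofReal (r (x.1 i) / w x.2 (x.1 i)) :=
    Finset.measurable_prod _ fun i _ => by
      have h1 : Measurable fun x : (Fin n → Z) × T => w x.2 (x.1 i) :=
        hw.comp (measurable_snd.prodMk ((measurable_pi_apply i).comp measurable_fst))
      fun_prop
  have hwθ : ∀ θ, Measurable (w θ) := fun θ => hw.comp (measurable_const.prodMk measurable_id)
  set N : (Fin n → Z) → ℝ≥0∞ :=
    fun d => ∫⁻ θ, k θ * ∏ i, ENNReal.ofReal (w θ (d i) / r (d i)) ∂π with hN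
  set A : (Fin n → Z) → ℝ≥0∞ :=
    fun d => ∫⁻ θ in S, ∏ i, ENNReal.ofReal (r (d i) / w θ (d i)) ∂π with hA
  have hNjoint : Measurable fun x : (Fin n → Z) × T =>
      k x.2 * ∏ i, ENNReal.ofReal (w x.2 (x.1 i) / r (x.1 i)) := (hk.comp measurable_snd).mul hratio
  have hNm : Measurable N := hNjoint.lintegral_prod_right'
  have hAm : Measurable A := hratio'.lintegral_prod_right'
  have hNE : ∫⁻ d, N d ∂ν ≤ ENNReal.ofReal J := by
    rw [hN, lintegral_lintegral_swap hNjoint.aemeasurable]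
    refine le_trans (lintegral_mono fun θ => ?_) hkJ
    have hmθ : Measurable fun d : Fin n → Z => ∏ i, ENNReal.ofReal (w θ (d i) / r (d i)) :=
      hratio.comp (measurable_id.prodMk measurable_const)
    rw [lintegral_const_mul _ hmθ,
      lintegral_pi_prod Q (g := fun z => ENNReal.ofReal (w θ z / r z))
        ((hwθ θ).div hr).ennreal_ofReal]
    gcongr
    calc _ ≤ ENNReal.ofReal (Real.exp (-(b * s θ))) ^ n := by gcongr; exact hlow θ
      _ = _ := by
        rw [← ENNReal.ofReal_pow (Real.exp_pos _).le, ← Real.exp_nat_mul]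
        congr 2
        ring
  have hAE : ∫⁻ d, A d ∂ν ≤ ENNReal.ofReal (Real.exp (n * (c * V)) * m) := by
    rw [hA, lintegral_lintegral_swap hratio'.aemeasurable]
    calc _ ≤ ∫⁻ _ in S, ENNReal.ofReal (Real.exp (n * (c * V))) ∂π := by
          refine setLIntegral_mono' hSm fun θ hθ => ?_
          rw [lintegral_pi_prod Q (g := fun z => ENNReal.ofReal (r z / w θ z))
            (hr.div (hwθ θ)).ennreal_ofReal]
          calc _ ≤ ENNReal.ofReal (Real.exp (c * s θ)) ^ n := by gcongr; exact hup θ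
            _ = ENNReal.ofReal (Real.exp (n * (c * s θ))) := by
              rw [← ENNReal.ofReal_pow (Real.exp_pos _).le, ← Real.exp_nat_mul]
            _ ≤ _ := by
              gcongr
              exact hV θ hθ
      _ = _ := by
          rw [setLIntegral_const, hS, ← ENNReal.ofReal_mul (Real.exp_pos _).le]
  -- Numerator and inverse density are each allowed to exceed `2/δ` times their mean bound with
  -- probability `δ/2`; the product of these factors is the `4/δ²` in the conclusion.
  have markov : ∀ {u : (Fin n → Z) → ℝ≥0∞} {x : ℝ}, Measurable u → 0 < x →
      ∫⁻ d, u d ∂ν ≤ ENNReal.ofReal x →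
      ν {d | ENNReal.ofReal (2 * x / δ) ≤ u d} ≤ ENNReal.ofReal (δ / 2) := by
    intro u x hu hx hle
    refine (meas_ge_le_lintegral_div hu.aemeasurable (by simp; positivity)
      ENNReal.ofReal_ne_top).trans ?_
    refine (ENNReal.div_le_div_right hle _).trans (le_of_eq ?_)
    rw [← ENNReal.ofReal_div_of_pos (by positivity)]
    congr 1
    field_simp
  have hNP := markov hNm hJ hNE
  have hAP := markov hAm (by positivity) hAE
  set B1 := {d | ENNReal.ofReal (2 * J / δ) ≤ N d}
  set B2 := {d | ENNReal.ofReal (2 * (Real.exp (n * (c * V)) * m) / δ) ≤ A d}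
  have hB1 : MeasurableSet B1 := measurableSet_le measurable_const hNm
  have hB2 : MeasurableSet B2 := measurableSet_le measurable_const hAm
  refine ⟨(B1 ∪ B2)ᶜ, (hB1.union hB2).compl, ?_, fun d hd => ?_⟩
  · rw [prob_compl_eq_one_sub (hB1.union hB2), ENNReal.ofReal_sub _ hδ.le, ENNReal.ofReal_one]
    gcongr
    calc ν (B1 ∪ B2) ≤ ν B1 + ν B2 := measure_union_le _ _
      _ ≤ ENNReal.ofReal (δ / 2) + ENNReal.ofReal (δ / 2) := by gcongr
      _ = ENNReal.ofReal δ := by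
        rw [← ENNReal.ofReal_add (by positivity) (by positivity), add_halves]
  · simp only [Set.mem_compl_iff, Set.mem_union, not_or, B1, B2, Set.mem_ofPred_eq, not_le] at hd
    refine (lintegral_likelihoodPosterior_le hw hw0 hwM hr0 hm (by positivity) hS d hd.2.le
      k).trans ?_
    calc _ ≤ ENNReal.ofReal (2 * (Real.exp (n * (c * V)) * m) / δ / m ^ 2)
          * ENNReal.ofReal (2 * J / δ) := by
          gcongr
          exact hd.1.le
      _ = _ := by
          rw [← ENNReal.ofReal_mul (by positivity)]
          congr 1
          field_simp
          ring

end Bound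

end PACBayes

/-! ### Regularity of the networks -/

section Network

variable {p L r : ℕ}

theorem continuous_hidden (k : ℕ) (i : Fin r) :
    Continuous fun z : Param p L r × EuclideanSpace ℝ (Fin p) => hidden z.1 z.2 k i := by
  induction k generalizing i with
  | zero =>
    simp only [hidden]
    fun_prop
  | succ k ih =>
    by_cases h : k < L - 1
    · simp only [hidden, h, dif_pos]
      fun_prop
    · simp only [hidden, h, dif_neg, not_false_eq_true]
      fun_prop

theorem continuous_clipped (C : ℝ) :
    Continuous fun z : Param p L r × EuclideanSpace ℝ (Fin p) => clipped C z.1 z.2 := by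
  have := continuous_hidden (p := p) (L := L) (r := r) (L - 1)
  unfold clipped network
  fun_prop

theorem measurable_clipped_uncurry (C : ℝ) :
    Measurable fun z : Param p L r × EuclideanSpace ℝ (Fin p) => clipped C z.1 z.2 :=
  (continuous_clipped C).measurable

theorem measurable_clipped (C : ℝ) (θ : Param p L r) : Measurable (clipped C θ) :=
  (measurable_clipped_uncurry C).comp (measurable_const.prodMk measurable_id)

theorem abs_clipped_le {C : ℝ} (hC : 0 ≤ C) (θ : Param p L r) (x : EuclideanSpace ℝ (Fin p)) :
    |clipped C θ x| ≤ C :=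
  abs_le.2 ⟨le_max_left _ _, max_le (by linarith) (min_le_right _ _)⟩

theorem abs_clipped_sub_le (C : ℝ) (θ θ' : Param p L r) (x : EuclideanSpace ℝ (Fin p)) :
    |clipped C θ x - clipped C θ' x| ≤ |network θ x - network θ' x| := by
  unfold clipped
  refine (abs_max_sub_max_le_max _ _ _ _).trans ?_
  rw [sub_self, abs_zero, max_eq_right (abs_nonneg _)]
  refine (abs_min_sub_min_le_max _ _ _ _).trans ?_
  rw [sub_self, abs_zero, max_eq_left (abs_nonneg _)]

theorem abs_affine_le {w h : Fin r → ℝ} {b B N : ℝ} (hw : ∀ j, |w j| ≤ B)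
    (hb : |b| ≤ B) (hh : ∀ j, |h j| ≤ N) : |(∑ j, w j * h j) + b| ≤ r * B * N + B := by
  have h1 : |∑ j, w j * h j| ≤ ∑ _j : Fin r, B * N := by
    refine (Finset.abs_sum_le_sum_abs _ _).trans (Finset.sum_le_sum fun j _ => ?_)
    rw [abs_mul]
    exact mul_le_mul (hw j) (hh j) (abs_nonneg _) ((abs_nonneg _).trans (hw j))
  rw [Finset.sum_const, Finset.card_univ, Fintype.card_fin, nsmul_eq_mul] at h1
  linarith [abs_add_le (∑ j, w j * h j) b]

theorem abs_affine_sub_le {w w' h h' : Fin r → ℝ} {b b' B N D δ : ℝ} (hδ : 0 ≤ δ)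
    (hw : ∀ j, |w j| ≤ B) (hww : ∀ j, |w j - w' j| ≤ δ) (hb : |b - b'| ≤ δ)
    (hh : ∀ j, |h' j| ≤ N) (hhh : ∀ j, |h j - h' j| ≤ D) :
    |((∑ j, w j * h j) + b) - ((∑ j, w' j * h' j) + b')| ≤ r * B * D + δ * (r * N + 1) := by
  have h1 : ((∑ j, w j * h j) + b) - ((∑ j, w' j * h' j) + b')
      = (∑ j, (w j * (h j - h' j) + (w j - w' j) * h' j)) + (b - b') := by
    rw [add_sub_add_comm, ← Finset.sum_sub_distrib]
    congr 1
    exact Finset.sum_congr rfl fun j _ => by ring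
  have h2 : |∑ j, (w j * (h j - h' j) + (w j - w' j) * h' j)| ≤ ∑ _j : Fin r, (B * D + δ * N) := by
    refine (Finset.abs_sum_le_sum_abs _ _).trans (Finset.sum_le_sum fun j _ => ?_)
    refine (abs_add_le _ _).trans (add_le_add ?_ ?_)
    · rw [abs_mul]
      exact mul_le_mul (hw j) (hhh j) (abs_nonneg _) ((abs_nonneg _).trans (hw j))
    · rw [abs_mul]
      exact mul_le_mul (hww j) (hh j) (abs_nonneg _) hδ
  rw [Finset.sum_const, Finset.card_univ, Fintype.card_fin, nsmul_eq_mul] at h2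
  rw [h1]
  refine (abs_add_le _ _).trans ?_
  linarith

theorem abs_max_zero_sub_le (a b : ℝ) : |max a 0 - max b 0| ≤ |a - b| := by
  simpa using abs_max_sub_max_le_max a 0 b 0

theorem abs_max_zero_le (a : ℝ) : |max a 0| ≤ |a| := by
  simpa using abs_max_zero_sub_le a 0

/-- The size of an input in the Lipschitz estimates. -/
noncomputable def inputSize (x : EuclideanSpace ℝ (Fin p)) : ℝ := 1 + ∑ j, |x j|

theorem one_le_inputSize (x : EuclideanSpace ℝ (Fin p)) : 1 ≤ inputSize x := by
  have : 0 ≤ ∑ j, |x j| := Finset.sum_nonneg fun _ _ => abs_nonneg _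
  unfold inputSize
  linarith

/-- The bounds obey `N_{k+1} = rB N_k + B`. Since `rB ≥ 1`, every shift costs at most one further
copy of the leading term, hence the linear factor `k + 1`. -/
theorem abs_hidden_le {B : ℝ} (hB : 1 ≤ B) (hr : 1 ≤ r) {θ : Param p L r} (hθ : ∀ i, |θ i| ≤ B)
    (x : EuclideanSpace ℝ (Fin p)) (k : ℕ) (i : Fin r) :
    |hidden θ x k i| ≤ (k + 1) * inputSize x * B * (r * B) ^ k := by
  have ha := one_le_inputSize x
  have hr' : (1 : ℝ) ≤ r := by exact_mod_cast hr
  have hrB : 1 ≤ r * B := by nlinarith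
  induction k generalizing i with
  | zero =>
    simp only [hidden]
    refine (abs_max_zero_le _).trans ?_
    have : |∑ j, θ (.inl (i, some j)) * x j| ≤ ∑ j, B * |x j| := by
      refine (Finset.abs_sum_le_sum_abs _ _).trans (Finset.sum_le_sum fun j _ => ?_)
      rw [abs_mul]
      gcongr
      exact hθ _
    rw [← Finset.mul_sum] at this
    have h2 := hθ (.inl (i, none))
    refine (abs_add_le _ _).trans ?_
    unfold inputSize
    simp
    linarith
  | succ k ih =>
    by_cases h : k < L - 1
    · simp only [hidden, h, dif_pos]
      refine (abs_max_zero_le _).trans ((abs_affine_le (fun j => hθ _) (hθ _)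
        ih).trans ?_)
      have hpow : 1 ≤ (r * B) ^ (k + 1) := one_le_pow₀ hrB
      have : B ≤ inputSize x * B * (r * B) ^ (k + 1) := by
        calc B = 1 * B * 1 := by ring
          _ ≤ _ := by gcongr
      push_cast
      rw [pow_succ] at this ⊢
      nlinarith
    -- Past the last hidden layer `hidden` has the default value 0.
    · simp only [hidden, h, dif_neg, not_false_eq_true, abs_zero]
      positivity

/-- The recursion is `D_{k+1} = rB D_k + δ (r N_k + 1)` with `N_k` from `abs_hidden_le`. Each layer
adds `k + 2` copies of the leading term, and these sum to triangular numbers. -/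
theorem abs_hidden_sub_le {B δ : ℝ} (hB : 1 ≤ B) (hr : 1 ≤ r) {θ θ' : Param p L r}
    (hθ : ∀ i, |θ i| ≤ B) (hθ' : ∀ i, |θ' i| ≤ B) (hδ : ∀ i, |θ i - θ' i| ≤ δ) (hδ0 : 0 ≤ δ)
    (x : EuclideanSpace ℝ (Fin p)) (k : ℕ) (i : Fin r) :
    |hidden θ x k i - hidden θ' x k i|
      ≤ (k + 1) * (k + 2) / 2 * inputSize x * δ * (r * B) ^ k := by
  have ha := one_le_inputSize x
  have hr' : (1 : ℝ) ≤ r := by exact_mod_cast hr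
  have hrB : 1 ≤ r * B := by nlinarith
  induction k generalizing i with
  | zero =>
    simp only [hidden]
    refine (abs_max_zero_sub_le _ _).trans ?_
    have h1 : |∑ j, (θ (.inl (i, some j)) - θ' (.inl (i, some j))) * x j| ≤ ∑ j, δ * |x j| := by
      refine (Finset.abs_sum_le_sum_abs _ _).trans (Finset.sum_le_sum fun j _ => ?_)
      rw [abs_mul]
      gcongr
      exact hδ _
    rw [← Finset.mul_sum] at h1
    have h2 := hδ (.inl (i, none))
    rw [add_sub_add_comm, ← Finset.sum_sub_distrib]
    simp_rw [← sub_mul]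
    refine (abs_add_le _ _).trans ?_
    unfold inputSize
    simp
    linarith
  | succ k ih =>
    by_cases h : k < L - 1
    · simp only [hidden, h, dif_pos]
      refine (abs_max_zero_sub_le _ _).trans ((abs_affine_sub_le hδ0 (fun j => hθ _)
        (fun j => hδ _) (hδ _) (abs_hidden_le hB hr hθ' x k) ih).trans ?_)
      have hpow : 1 ≤ (r * B) ^ (k + 1) := one_le_pow₀ hrB
      have : 1 ≤ inputSize x * (r * B) ^ (k + 1) := one_le_mul_of_one_le_of_one_le ha hpow
      have h3 := mul_le_mul_of_nonneg_left this hδ0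
      push_cast
      rw [pow_succ] at h3 ⊢
      nlinarith
    · simp only [hidden, h, dif_neg, not_false_eq_true, sub_zero, abs_zero]
      positivity

theorem succ_mul_succ_le_two_pow (L : ℕ) : ((L : ℝ) + 1) * (L + 2) / 2 ≤ 2 * 2 ^ L := by
  induction L with
  | zero => norm_num
  | succ k ih =>
    rcases Nat.eq_zero_or_pos k with rfl | hk
    · norm_num
    · have : (1 : ℝ) ≤ k := by exact_mod_cast hk
      push_cast
      rw [pow_succ]
      nlinarith

/-- The output layer is one more affine step and yields the factor `(L+1)(L+2)/2 · (rB)^L`.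
Absorbing the polynomial into `2 · 2^L` produces the scale `(2rB)^L` that appears in the parameter
critical value. -/
theorem abs_network_sub_le {B δ : ℝ} (hB : 1 ≤ B) (hr : 1 ≤ r) (hL : 1 ≤ L) {θ θ' : Param p L r}
    (hθ : ∀ i, |θ i| ≤ B) (hθ' : ∀ i, |θ' i| ≤ B) (hδ : ∀ i, |θ i - θ' i| ≤ δ) (hδ0 : 0 ≤ δ)
    (x : EuclideanSpace ℝ (Fin p)) :
    |network θ x - network θ' x| ≤ 2 * (2 * r * B) ^ L * inputSize x * δ := by
  have ha := one_le_inputSize x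
  have hr' : (1 : ℝ) ≤ r := by exact_mod_cast hr
  have hrB : 1 ≤ r * B := by nlinarith
  obtain ⟨k, rfl⟩ : ∃ k, L = k + 1 := ⟨L - 1, by omega⟩
  have hpow : 1 ≤ (r * B) ^ (k + 1) := one_le_pow₀ hrB
  have h1 : 1 ≤ inputSize x * (r * B) ^ (k + 1) := one_le_mul_of_one_le_of_one_le ha hpow
  have h3 := mul_le_mul_of_nonneg_left h1 hδ0
  have h4 := abs_hidden_le hB hr hθ' x k
  have h5 := abs_hidden_sub_le hB hr hθ hθ' hδ hδ0 x k
  unfold network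
  calc _ ≤ r * B * ((k + 1) * (k + 2) / 2 * inputSize x * δ * (r * B) ^ k)
        + δ * (r * ((k + 1) * inputSize x * B * (r * B) ^ k) + 1) :=
        abs_affine_sub_le hδ0 (fun j => hθ _) (fun j => hδ _) (hδ _) h4 h5
    _ ≤ (((k + 1 : ℕ) : ℝ) + 1) * ((k + 1 : ℕ) + 2) / 2 * (inputSize x * δ * (r * B) ^ (k + 1)) := by
        push_cast
        rw [pow_succ] at h3 ⊢
        nlinarith
    _ ≤ 2 * 2 ^ (k + 1) * (inputSize x * δ * (r * B) ^ (k + 1)) := by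
        gcongr
        exact succ_mul_succ_le_two_pow (k + 1)
    _ = _ := by
        rw [mul_assoc 2 (r : ℝ) B, mul_pow 2 (r * B)]
        ring

theorem sq_inputSize_le (x : EuclideanSpace ℝ (Fin p)) :
    inputSize x ^ 2 ≤ 2 + 2 * p * ‖x‖ ^ 2 := by
  have h1 : (∑ j, |x j|) ^ 2 ≤ p * ‖x‖ ^ 2 := by
    have := sq_sum_le_card_mul_sum_sq (s := Finset.univ) (f := fun j => |x j|)
    rw [EuclideanSpace.norm_sq_eq]
    simpa using this
  unfold inputSize
  nlinarith [sq_nonneg (1 - ∑ j, |x j|)]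

theorem abs_le_of_mem_cube {B : ℝ} {θ : Param p L r} (hθ : θ ∈ cube p L r B) (i) : |θ i| ≤ B :=
  abs_le.2 ⟨hθ.1 i, hθ.2 i⟩

/-- The Lipschitz constant of a network in its parameters grows with the input, so the second moment
of the input enters: the mean of `inputSize²` is at most `2 + 2pK ≤ 4pK`. -/
theorem IsBoundedRegression.sqDist_clipped_le {Ω : Type*} [MeasurableSpace Ω] {P : Measure Ω}
    [IsProbabilityMeasure P] {X : Ω → EuclideanSpace ℝ (Fin p)} {Y : Ω → ℝ}
    {f : EuclideanSpace ℝ (Fin p) → ℝ} {C K σ Γ : ℝ} (H : IsBoundedRegression P X Y f C K σ Γ)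
    (hC : 0 ≤ C) (hK : 1 ≤ K) (hp : 1 ≤ p) (hL : 1 ≤ L) (hr : 1 ≤ r) {B : ℝ} (hB : 1 ≤ B)
    {θ θ' : Param p L r} (hθ : θ ∈ cube p L r B) (hθ' : θ' ∈ cube p L r B) :
    sqDist (P.map X) f (clipped C θ) ≤ 2 * sqDist (P.map X) f (clipped C θ')
      + 32 * p * K * ((2 * r * B) ^ L * ‖θ - θ'‖) ^ 2 := by
  have := H.isProbabilityMeasure_map
  set δ := ‖θ - θ'‖
  have hδ : ∀ i, |θ i - θ' i| ≤ δ := fun i => norm_le_pi_norm (θ - θ') i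
  have i1 := integrable_sq_sub H.measurable_f (measurable_clipped C θ) H.bounded
    (ae_of_all _ (abs_clipped_le hC θ))
  have i2 := integrable_sq_sub H.measurable_f (measurable_clipped C θ') H.bounded
    (ae_of_all _ (abs_clipped_le hC θ'))
  have i3 : Integrable (fun x => ‖x‖ ^ 2) (P.map X) := by
    rw [integrable_map_measure (by fun_prop) H.measurable_X.aemeasurable]
    exact H.integrable_input
  have h3 : ∫ x, ‖x‖ ^ 2 ∂(P.map X) ≤ K := by
    rw [integral_map H.measurable_X.aemeasurable (by fun_prop)]
    exact H.second_moment
  have i4 : Integrable (fun x : EuclideanSpace ℝ (Fin p) =>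
      8 * ((2 * r * B) ^ L * δ) ^ 2 * (2 + 2 * p * ‖x‖ ^ 2)) (P.map X) :=
    ((integrable_const _).add (i3.const_mul _)).const_mul _
  have hpt : ∀ x, (clipped C θ x - f x) ^ 2 ≤ 2 * (clipped C θ' x - f x) ^ 2
      + 8 * ((2 * r * B) ^ L * δ) ^ 2 * (2 + 2 * p * ‖x‖ ^ 2) := by
    intro x
    have h1 : |clipped C θ x - clipped C θ' x| ≤ 2 * (2 * r * B) ^ L * inputSize x * δ :=
      (abs_clipped_sub_le C θ θ' x).trans (abs_network_sub_le hB hr hL (abs_le_of_mem_cube hθ)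
        (abs_le_of_mem_cube hθ') hδ (norm_nonneg _) x)
    have h2 : (clipped C θ x - clipped C θ' x) ^ 2 ≤
        4 * ((2 * r * B) ^ L * δ) ^ 2 * (2 + 2 * p * ‖x‖ ^ 2) := by
      rw [← sq_abs]
      calc _ ≤ (2 * (2 * r * B) ^ L * inputSize x * δ) ^ 2 := by gcongr
        _ = 4 * ((2 * r * B) ^ L * δ) ^ 2 * inputSize x ^ 2 := by ring
        _ ≤ _ := by
          gcongr
          exact sq_inputSize_le x
    nlinarith [sq_nonneg ((clipped C θ x - clipped C θ' x) - (clipped C θ' x - f x))]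
  calc sqDist (P.map X) f (clipped C θ)
      ≤ ∫ x, (2 * (clipped C θ' x - f x) ^ 2
        + 8 * ((2 * r * B) ^ L * δ) ^ 2 * (2 + 2 * p * ‖x‖ ^ 2)) ∂(P.map X) :=
        integral_mono i1 ((i2.const_mul 2).add i4) hpt
    _ = 2 * sqDist (P.map X) f (clipped C θ')
        + 8 * ((2 * r * B) ^ L * δ) ^ 2 * (2 + 2 * p * ∫ x, ‖x‖ ^ 2 ∂(P.map X)) := by
        rw [integral_add (i2.const_mul 2) i4, integral_const_mul, integral_const_mul,
          integral_add (integrable_const _) (i3.const_mul _), integral_const_mul]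
        simp [sqDist]
    _ ≤ 2 * sqDist (P.map X) f (clipped C θ')
        + 8 * ((2 * r * B) ^ L * δ) ^ 2 * (4 * p * K) := by
        have hp' : (1 : ℝ) ≤ p := by exact_mod_cast hp
        gcongr
        have : (p : ℝ) * ∫ x, ‖x‖ ^ 2 ∂(P.map X) ≤ p * K := by gcongr
        nlinarith
    _ = _ := by ring

/-! ### The prior -/

theorem volume_cube {B : ℝ} (hB : 0 ≤ B) :
    volume (cube p L r B) = ENNReal.ofReal ((2 * B) ^ numParams p L r) := by
  rw [cube, Real.volume_Icc_pi, ← card_paramIndex, ENNReal.ofReal_pow (by positivity)]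
  simp [two_mul]

theorem isProbabilityMeasure_prior {B : ℝ} (hB : 0 < B) :
    IsProbabilityMeasure (prior p L r B) :=
  cond_isProbabilityMeasure_of_finite (by rw [volume_cube hB.le]; simp; positivity)
    (by rw [volume_cube hB.le]; simp)

theorem prior_apply {B : ℝ} (hB : 0 < B) (S : Set (Param p L r)) :
    prior p L r B S = volume (cube p L r B ∩ S) / ENNReal.ofReal ((2 * B) ^ numParams p L r) := by
  have hm : MeasurableSet (cube p L r B) := measurableSet_Icc
  rw [prior, cond_apply hm, volume_cube hB.le, ENNReal.div_eq_inv_mul]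

theorem prior_closedBall_le {B u : ℝ} (hB : 0 < B) (hu : 0 ≤ u) :
    prior p L r B {θ | ‖θ‖ ≤ u} ≤ ENNReal.ofReal ((u / B) ^ numParams p L r) := by
  rw [prior_apply hB]
  have h1 : cube p L r B ∩ {θ | ‖θ‖ ≤ u} ⊆ cube p L r u := fun θ hθ =>
    ⟨fun i => (abs_le.1 ((norm_le_pi_norm θ i).trans hθ.2)).1,
      fun i => (abs_le.1 ((norm_le_pi_norm θ i).trans hθ.2)).2⟩
  refine (ENNReal.div_le_div_right (measure_mono h1) _).trans (le_of_eq ?_)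
  rw [volume_cube hu, ← ENNReal.ofReal_div_of_pos (by positivity), ← div_pow,
    mul_div_mul_left _ _ two_ne_zero]

/-- Even if `θs` lies in a corner of the cube, each coordinate interval keeps length at least `u`
after intersection with `[-B, B]`; this is where `u ≤ 2B` is needed. -/
theorem le_prior_closedBall {B u : ℝ} (hB : 0 < B) (hu : 0 ≤ u) (huB : u ≤ 2 * B)
    {θs : Param p L r} (hθs : θs ∈ cube p L r B) :
    ENNReal.ofReal ((u / (2 * B)) ^ numParams p L r) ≤
      prior p L r B {θ | θ ∈ cube p L r B ∧ ‖θ - θs‖ ≤ u} := by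
  rw [prior_apply hB, div_pow, ENNReal.ofReal_div_of_pos (by positivity)]
  gcongr
  have h1 : Set.Icc (fun i => max (-B) (θs i - u)) (fun i => min B (θs i + u)) ⊆
      cube p L r B ∩ {θ | θ ∈ cube p L r B ∧ ‖θ - θs‖ ≤ u} := by
    intro θ hθ
    have h2 : θ ∈ cube p L r B := ⟨fun i => (le_max_left _ _).trans (hθ.1 i),
      fun i => (hθ.2 i).trans (min_le_left _ _)⟩
    refine ⟨h2, h2, (pi_norm_le_iff_of_nonneg hu).2 fun i => ?_⟩
    have h3 := (le_max_right _ _).trans (hθ.1 i)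
    have h4 := (hθ.2 i).trans (min_le_right _ _)
    rw [Pi.sub_apply, Real.norm_eq_abs, abs_le]
    constructor <;> linarith
  refine le_trans ?_ (measure_mono h1)
  rw [Real.volume_Icc_pi, ← card_paramIndex, ENNReal.ofReal_pow hu]
  calc ENNReal.ofReal u ^ Fintype.card (ParamIndex p L r)
      = ∏ _i : ParamIndex p L r, ENNReal.ofReal u := by simp
    _ ≤ _ := by
      refine Finset.prod_le_prod' fun i _ => ENNReal.ofReal_le_ofReal ?_
      have h5 := hθs.1 i
      have h6 := hθs.2 i
      simp only at h5 h6
      rcases max_cases (-B) (θs i - u) with h | h <;> rcases min_cases B (θs i + u) with h' | h' <;>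
        linarith [h.1, h'.1]

theorem numParams_le (hp : 1 ≤ p) (hL : 1 ≤ L) (hr : 1 ≤ r) :
    numParams p L r ≤ 4 * p * L * r ^ 2 := by
  obtain ⟨p, rfl⟩ : ∃ k, p = k + 1 := ⟨p - 1, by omega⟩
  obtain ⟨L, rfl⟩ : ∃ k, L = k + 1 := ⟨L - 1, by omega⟩
  obtain ⟨r, rfl⟩ : ∃ k, r = k + 1 := ⟨r - 1, by omega⟩
  simp only [numParams, Nat.add_sub_cancel]
  nlinarith [Nat.zero_le (p * L * r ^ 2), Nat.zero_le (p * L * r), Nat.zero_le (p * r ^ 2),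
    Nat.zero_le (L * r ^ 2), Nat.zero_le (p * L), Nat.zero_le (p * r), Nat.zero_le (L * r),
    Nat.zero_le (r ^ 2)]

theorem one_le_numParams : 1 ≤ numParams p L r := by
  unfold numParams
  omega

end Network

/-! ### Concentration of the surrogate posterior -/

section Posterior

/-- Markov's inequality for exponential moments. -/
theorem measure_not_le_of_lintegral_exp_le {T : Type*} [MeasurableSpace T] {π : Measure T}
    {s : T → ℝ} (hs : Measurable s) {t q η : ℝ} (ht : 0 < t) (hq : 0 < q) (hη : 0 < η)
    (hle : ∫⁻ θ, ENNReal.ofReal (Real.exp (t * s θ)) ∂π ≤ ENNReal.ofReal q) :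
    π {θ | s θ ≤ (Real.log q + Real.log (1 / η)) / t}ᶜ ≤ ENNReal.ofReal η := by
  have h1 : {θ | s θ ≤ (Real.log q + Real.log (1 / η)) / t}ᶜ ⊆
      {θ | ENNReal.ofReal (q / η) ≤ ENNReal.ofReal (Real.exp (t * s θ))} := by
    intro θ hθ
    simp only [Set.mem_compl_iff, Set.mem_ofPred_eq, not_le] at hθ ⊢
    refine ENNReal.ofReal_le_ofReal ?_
    rw [div_lt_iff₀ ht, ← Real.log_mul hq.ne' (by positivity)] at hθ
    rw [← Real.exp_log (show 0 < q / η by positivity)]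
    gcongr
    rw [div_eq_mul_one_div]
    linarith
  refine (measure_mono h1).trans ((meas_ge_le_lintegral_div (by fun_prop) (by simp; positivity)
    ENNReal.ofReal_ne_top).trans ?_)
  refine (ENNReal.div_le_div_right hle _).trans (le_of_eq ?_)
  rw [← ENNReal.ofReal_div_of_pos (by positivity)]
  congr 1
  field_simp

/-- Jensen's inequality for the logarithm, through the tangent bound `x + 1 ≤ exp x` at `x = t s -
log q`. -/
theorem integral_le_of_lintegral_exp_le {T : Type*} [MeasurableSpace T] {π : Measure T}
    [IsProbabilityMeasure π] {s : T → ℝ} (hs : Measurable s) (hi : Integrable s π) {t q : ℝ}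
    (ht : 0 < t) (hq : 0 < q)
    (hle : ∫⁻ θ, ENNReal.ofReal (Real.exp (t * s θ)) ∂π ≤ ENNReal.ofReal q) :
    ∫ θ, s θ ∂π ≤ Real.log q / t := by
  have he : Integrable (fun θ => Real.exp (t * s θ)) π := by
    refine ⟨by fun_prop, ?_⟩
    rw [hasFiniteIntegral_iff_ofReal (ae_of_all _ fun e => by positivity)]
    exact hle.trans_lt ENNReal.ofReal_lt_top
  rw [← ofReal_integral_eq_lintegral_ofReal he (ae_of_all _ fun θ => by positivity),
    ENNReal.ofReal_le_ofReal_iff hq.le] at hle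
  have h1 : ∫ θ, (t * s θ - Real.log q + 1) ∂π ≤ ∫ θ, Real.exp (t * s θ) / q ∂π := by
    refine integral_mono (((hi.const_mul t).sub (integrable_const _)).add (integrable_const _))
      (he.div_const q) fun θ => ?_
    have := Real.add_one_le_exp (t * s θ - Real.log q)
    rwa [Real.exp_sub, Real.exp_log hq] at this
  have h2 : Integrable (fun θ => t * s θ - Real.log q) π :=
    (hi.const_mul t).sub (integrable_const _)
  rw [integral_add h2 (integrable_const _), integral_sub (hi.const_mul t) (integrable_const _),
    integral_const_mul, integral_div] at h1
  have h3 : (∫ θ, Real.exp (t * s θ) ∂π) / q ≤ 1 := (div_le_one hq).2 hle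
  simp only [integral_const, probReal_univ, smul_eq_mul, one_mul] at h1
  rw [le_div_iff₀ ht]
  linarith

variable {p L r : ℕ} {E : Type*} [MeasurableSpace E]

theorem measurable_sqDist {T : Type*} [MeasurableSpace T] {μ : Measure E} [SFinite μ] {f : E → ℝ}
    (hf : Measurable f) {F : T → E → ℝ} (hF : Measurable (Function.uncurry F)) :
    Measurable fun θ => sqDist μ f (F θ) := by
  have h : Measurable fun z : T × E => (F z.1 z.2 - f z.2) ^ 2 := by
    have h1 : Measurable fun z : T × E => F z.1 z.2 := hF
    fun_prop
  exact h.stronglyMeasurable.integral_prod_right'.measurable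

theorem sqDist_le {μ : Measure E} [IsProbabilityMeasure μ] {f h : E → ℝ} {C : ℝ}
    (hf : Measurable f) (hh : Measurable h) (hfC : ∀ᵐ x ∂μ, |f x| ≤ C) (hhC : ∀ x, |h x| ≤ C) :
    sqDist μ f h ≤ (2 * C) ^ 2 := by
  have h1 := integrable_sq_sub hf hh hfC (ae_of_all _ hhC)
  calc sqDist μ f h ≤ ∫ _, (2 * C) ^ 2 ∂μ := by
        refine integral_mono_ae h1 (integrable_const _) ?_
        filter_upwards [hfC] with x hx
        have h2 := abs_le.1 hx
        have h3 := abs_le.1 (hhC x)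
        exact sq_le_sq' (by linarith) (by linarith)
    _ = _ := by simp

/-- The squared distance of a mean is at most the mean of the squared distances. -/
theorem sqDist_integral_le {T : Type*} [MeasurableSpace T] {π : Measure T}
    [IsProbabilityMeasure π] {μ : Measure E} [IsProbabilityMeasure μ] {f : E → ℝ} {C : ℝ}
    (hf : Measurable f) (hfC : ∀ᵐ x ∂μ, |f x| ≤ C) {F : T → E → ℝ}
    (hF : Measurable (Function.uncurry F)) (hFC : ∀ θ x, |F θ x| ≤ C) :
    sqDist μ f (fun x => ∫ θ, F θ x ∂π) ≤ ∫ θ, sqDist μ f (F θ) ∂π := by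
  have hjoint : Measurable fun z : T × E => (F z.1 z.2 - f z.2) ^ 2 := by
    have h1 : Measurable fun z : T × E => F z.1 z.2 := hF
    fun_prop
  have hint : Integrable (fun z : T × E => (F z.1 z.2 - f z.2) ^ 2) (π.prod μ) := by
    refine Integrable.of_bound hjoint.aestronglyMeasurable ((2 * C) ^ 2) ?_
    filter_upwards [(Measure.quasiMeasurePreserving_snd (μ := π) (ν := μ)).ae hfC] with z hz
    rw [Real.norm_eq_abs, abs_of_nonneg (sq_nonneg _)]
    have h2 := abs_le.1 hz
    have h3 := abs_le.1 (hFC z.1 z.2)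
    exact sq_le_sq' (by linarith) (by linarith)
  have hFx : ∀ x, Measurable fun θ => F θ x := fun x =>
    hF.comp (measurable_id.prodMk measurable_const)
  have hFi : ∀ x, Integrable (fun θ => F θ x) π := fun x =>
    Integrable.of_bound (hFx x).aestronglyMeasurable C (ae_of_all _ fun θ => hFC θ x)
  have hpt : ∀ x, (∫ θ, F θ x ∂π - f x) ^ 2 ≤ ∫ θ, (F θ x - f x) ^ 2 ∂π := by
    intro x
    have hi1 : Integrable (fun θ => F θ x - f x) π := (hFi x).sub (integrable_const _)
    have hi2 : Integrable (fun θ => (F θ x - f x) ^ 2) π := by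
      refine Integrable.of_bound ((hFx x).sub_const _ |>.pow_const 2).aestronglyMeasurable
        ((C + |f x|) ^ 2) (ae_of_all _ fun θ => ?_)
      rw [Real.norm_eq_abs, abs_pow]
      gcongr
      exact (abs_sub _ _).trans (by linarith [hFC θ x])
    have := (even_two.convexOn_pow (𝕜 := ℝ)).map_integral_le (continuous_pow 2).continuousOn
      isClosed_univ (ae_of_all _ fun θ => Set.mem_univ _) hi1 hi2
    rwa [integral_sub (hFi x) (integrable_const _), integral_const, probReal_univ, one_smul] at this
  calc sqDist μ f (fun x => ∫ θ, F θ x ∂π) ≤ ∫ x, ∫ θ, (F θ x - f x) ^ 2 ∂π ∂μ :=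
        integral_mono_of_nonneg (ae_of_all _ fun x => sq_nonneg _) hint.integral_prod_right
          (ae_of_all _ hpt)
    _ = _ := (integral_integral_swap hint).symm

/-- The temperature `λ = n/Ξ` removes `n` from the weight of a single observation, so the posterior
has product form with a weight independent of the sample size. -/
theorem surrogatePosterior_eq {n : ℕ} (hn : n ≠ 0) {C B Ξ ρ : ℝ} (hΞ : 0 < Ξ)
    (d : Fin n → EuclideanSpace ℝ (Fin p) × ℝ) :
    surrogatePosterior L r C B (n / Ξ) ρ d = likelihoodPosterior (prior p L r B)
      (fun θ z => residualWeight Ξ (1 - ρ) (z.2 - clipped C θ z.1)) d := by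
  unfold surrogatePosterior likelihoodPosterior
  congr 1
  ext θ
  have hn' : (n : ℝ) ≠ 0 := by exact_mod_cast hn
  unfold surrogateRisk
  rw [← mul_assoc, show -((n : ℝ) / Ξ) * -(1 / (n / Ξ)) = 1 by field_simp, one_mul]
  refine Finset.sum_congr rfl fun i _ => ?_
  unfold residualWeight loss
  rw [show -((n : ℝ) / Ξ / n) * ((d i).2 - clipped C θ (d i).1) ^ 2
    = -(((d i).2 - clipped C θ (d i).1) ^ 2 / Ξ) by field_simp, add_sub_assoc]

theorem measurable_residualWeight_clipped {C Ξ a : ℝ} :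
    Measurable (Function.uncurry fun (θ : Param p L r) (z : EuclideanSpace ℝ (Fin p) × ℝ) =>
      residualWeight Ξ a (z.2 - clipped C θ z.1)) := by
  have h : Measurable fun x : Param p L r × (EuclideanSpace ℝ (Fin p) × ℝ) =>
      clipped C x.1 x.2.1 :=
    (measurable_clipped_uncurry C).comp (measurable_fst.prodMk (measurable_fst.comp measurable_snd))
  exact (measurable_residualWeight Ξ a).comp ((measurable_snd.comp measurable_snd).sub h)

theorem residualWeight_le {Ξ a : ℝ} (hΞ : 0 < Ξ) (ha1 : a ≤ 1) (u : ℝ) :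
    residualWeight Ξ a u ≤ 2 := by
  have : Real.exp (-(u ^ 2 / Ξ)) ≤ 1 := Real.exp_le_one_iff.2 (by simp; positivity)
  unfold residualWeight
  linarith

theorem isProbabilityMeasure_surrogatePosterior {n : ℕ} (hn : n ≠ 0) {C B Ξ ρ : ℝ} (hΞ : 0 < Ξ)
    (hB : 0 < B) (hρ : 0 < ρ) (hρ1 : ρ ≤ 1) (d : Fin n → EuclideanSpace ℝ (Fin p) × ℝ) :
    IsProbabilityMeasure (surrogatePosterior L r C B (n / Ξ) ρ d) := by
  have := isProbabilityMeasure_prior (p := p) (L := L) (r := r) hB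
  rw [surrogatePosterior_eq hn hΞ]
  exact isProbabilityMeasure_likelihoodPosterior measurable_residualWeight_clipped
    (fun θ z => residualWeight_pos (by linarith) _)
    (fun θ z => residualWeight_le hΞ (by linarith) _) d

theorem IsSample.aemeasurable {Ω : Type*} [MeasurableSpace Ω] {P : Measure Ω}
    {X : Ω → EuclideanSpace ℝ (Fin p)} {Y : Ω → ℝ} {n : ℕ}
    {D : Fin n → Ω → EuclideanSpace ℝ (Fin p) × ℝ} (hD : IsSample P X Y D) :
    AEMeasurable (fun ω i => D i ω) P :=
  aemeasurable_pi_lambda _ fun i => (hD.identDistrib i).aemeasurable_fst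

theorem IsSample.map_eq {Ω : Type*} [MeasurableSpace Ω] {P : Measure Ω} [IsProbabilityMeasure P]
    {X : Ω → EuclideanSpace ℝ (Fin p)} {Y : Ω → ℝ} {n : ℕ}
    {D : Fin n → Ω → EuclideanSpace ℝ (Fin p) × ℝ} (hD : IsSample P X Y D) :
    P.map (fun ω i => D i ω) = Measure.pi fun _ => P.map fun ω => (X ω, Y ω) := by
  rw [(iIndepFun_iff_map_fun_eq_pi_map fun i => (hD.identDistrib i).aemeasurable_fst).1 hD.indep]
  simp_rw [fun i => (hD.identDistrib i).map_eq]

variable {Ω : Type*} [MeasurableSpace Ω] {P : Measure Ω} [IsProbabilityMeasure P]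
  {X : Ω → EuclideanSpace ℝ (Fin p)} {Y : Ω → ℝ} {f : EuclideanSpace ℝ (Fin p) → ℝ}
  {C K σ Γ Ξ B ρ : ℝ} {n : ℕ} {D : Fin n → Ω → EuclideanSpace ℝ (Fin p) × ℝ}
  {θs : Param p L r}

theorem IsBoundedRegression.measurable_sqDist_clipped (H : IsBoundedRegression P X Y f C K σ Γ) :
    Measurable fun θ : Param p L r => sqDist (P.map X) f (clipped C θ) := by
  have := H.isProbabilityMeasure_map
  exact measurable_sqDist H.measurable_f (measurable_clipped_uncurry C)

theorem IsBoundedRegression.exists_event (H : IsBoundedRegression P X Y f C K σ Γ)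
    (hD : IsSample P X Y D) (hΞ : IsTemperature C σ Γ Ξ) (hK : 1 ≤ K) (hB : 1 ≤ B) (hρ : 0 < ρ)
    (hρ1 : ρ ≤ 1) (hp : 1 ≤ p) (hL : 1 ≤ L) (hr : 1 ≤ r) (hn : n ≠ 0)
    (hθs : θs ∈ cube p L r B) {u : ℝ} (hu : 0 < u) (huB : u ≤ 2 * B)
    {k : Param p L r → ℝ≥0∞} (hk : Measurable k) {J : ℝ} (hJ : 0 < J)
    (hkJ : ∫⁻ θ, k θ * ENNReal.ofReal
      (Real.exp (-(n * (1 / (4 * Ξ) * sqDist (P.map X) f (clipped C θ))))) ∂(prior p L r B)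
        ≤ ENNReal.ofReal J) {δ : ℝ} (hδ : 0 < δ) :
    ∃ G : Set (Fin n → EuclideanSpace ℝ (Fin p) × ℝ), MeasurableSet G ∧
      ENNReal.ofReal (1 - δ) ≤ (P.map fun ω i => D i ω) G ∧
      ∀ d ∈ G, ∫⁻ θ, k θ ∂(surrogatePosterior L r C B (n / Ξ) ρ d)
        ≤ ENNReal.ofReal (4 / δ ^ 2 * Real.exp (n * (3 / (2 * Ξ) *
          (2 * sqDist (P.map X) f (clipped C θs) + 32 * p * K * ((2 * r * B) ^ L * u) ^ 2))) * J
            / (u / (2 * B)) ^ numParams p L r) := by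
  have hB0 : 0 < B := by linarith
  have hΞ0 := hΞ.pos
  have hC0 := hΞ.C_pos.le
  have ha : 0 ≤ 1 - ρ := by linarith
  have ha1 : 1 - ρ ≤ 1 := by linarith
  have hf := H.measurable_f
  have := isProbabilityMeasure_prior (p := p) (L := L) (r := r) hB0
  have : IsProbabilityMeasure (P.map fun ω => (X ω, Y ω)) :=
    Measure.isProbabilityMeasure_map (H.measurable_X.prodMk H.measurable_Y).aemeasurable
  set S := {θ : Param p L r | θ ∈ cube p L r B ∧ ‖θ - θs‖ ≤ u} with hS
  have hSm : MeasurableSet S := by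
    have h1 : MeasurableSet (cube p L r B) := measurableSet_Icc
    have h2 : MeasurableSet {θ : Param p L r | ‖θ - θs‖ ≤ u} :=
      measurableSet_le (measurable_id.sub_const θs).norm measurable_const
    exact h1.inter h2
  set m := (prior p L r B S).toReal with hm
  have hSm' : prior p L r B S = ENNReal.ofReal m := (ENNReal.ofReal_toReal (by simp)).symm
  have hmle : (u / (2 * B)) ^ numParams p L r ≤ m := by
    have := le_prior_closedBall hB0 hu.le huB hθs
    rwa [← hS, hSm', ENNReal.ofReal_le_ofReal_iff ENNReal.toReal_nonneg] at this
  have hu0 : 0 < (u / (2 * B)) ^ numParams p L r := by positivity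
  have hm0 : 0 < m := hu0.trans_le hmle
  have hlow : ∀ θ : Param p L r, ∫⁻ z, ENNReal.ofReal (residualWeight Ξ (1 - ρ)
      (z.2 - clipped C θ z.1) / residualWeight Ξ (1 - ρ) (z.2 - f z.1))
        ∂(P.map fun ω => (X ω, Y ω)) ≤
      ENNReal.ofReal (Real.exp (-(1 / (4 * Ξ) * sqDist (P.map X) f (clipped C θ)))) := fun θ => by
    refine (H.lintegral_ratio_le hΞ ha ha1 (measurable_clipped C θ) (abs_clipped_le hC0 θ)).trans
      (le_of_eq ?_)
    rw [div_eq_inv_mul, ← one_div]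
  have hup : ∀ θ : Param p L r, ∫⁻ z, ENNReal.ofReal (residualWeight Ξ (1 - ρ) (z.2 - f z.1)
      / residualWeight Ξ (1 - ρ) (z.2 - clipped C θ z.1)) ∂(P.map fun ω => (X ω, Y ω)) ≤
      ENNReal.ofReal (Real.exp (3 / (2 * Ξ) * sqDist (P.map X) f (clipped C θ))) := fun θ => by
    refine (H.lintegral_ratio_inv_le hΞ ha (measurable_clipped C θ) (abs_clipped_le hC0 θ)).trans
      (le_of_eq ?_)
    rw [mul_div_right_comm]
  have hV : ∀ θ ∈ S, sqDist (P.map X) f (clipped C θ) ≤ 2 * sqDist (P.map X) f (clipped C θs)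
      + 32 * p * K * ((2 * r * B) ^ L * u) ^ 2 := fun θ hθ => by
    refine (H.sqDist_clipped_le hC0 hK hp hL hr hB hθ.1 hθs).trans ?_
    have h2 := hθ.2
    gcongr
  have hr' : Measurable fun z : EuclideanSpace ℝ (Fin p) × ℝ =>
      residualWeight Ξ (1 - ρ) (z.2 - f z.1) := by fun_prop
  obtain ⟨G, hG, hGP, hGk⟩ := exists_event_lintegral_posterior_le (n := n)
    (P.map fun ω => (X ω, Y ω)) measurable_residualWeight_clipped
    (fun θ z => residualWeight_pos ha _) (fun θ z => residualWeight_le hΞ0 ha1 _) hr'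
    (fun z => residualWeight_pos ha _) (by positivity) hlow hup hSm hm0 hSm' hV hk hJ hkJ hδ
  refine ⟨G, hG, by rwa [hD.map_eq], fun d hd => ?_⟩
  rw [surrogatePosterior_eq hn hΞ0]
  refine (hGk d hd).trans (ENNReal.ofReal_le_ofReal ?_)
  gcongr

end Posterior

/-! ### Posterior concentration around the oracle and small balls at the origin -/

section Oracle

variable {p L r : ℕ} {Ω : Type*} [MeasurableSpace Ω] {P : Measure Ω} [IsProbabilityMeasure P]
  {X : Ω → EuclideanSpace ℝ (Fin p)} {Y : Ω → ℝ} {f : EuclideanSpace ℝ (Fin p) → ℝ}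
  {C K σ Γ Ξ B ρ : ℝ} {n : ℕ} {D : Fin n → Ω → EuclideanSpace ℝ (Fin p) × ℝ}
  {θs : Param p L r}

theorem IsLargeSample.half_le_log (hn : IsLargeSample n p L r B K) : 1 / 2 ≤ Real.log n := by
  have h1 : (2 : ℝ) ≤ n := by exact_mod_cast hn.1
  have h2 := Real.log_le_log (by norm_num) h1
  linarith [Real.log_two_gt_d9]

theorem IsLargeSample.log_cube_le (hn : IsLargeSample n p L r B K) (hB : 1 ≤ B) (hL : 1 ≤ L)
    (hr : 1 ≤ r) :
    Real.log (2 * B * ((2 * r * B) ^ L * (n : ℝ) ^ 2)) ≤ 7 * (L * Real.log n) := by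
  obtain ⟨h2, hBn, -, -, hrn, -⟩ := hn
  have h2' : (2 : ℝ) ≤ n := by exact_mod_cast h2
  have hrn' : (r : ℝ) ≤ n := by exact_mod_cast hrn
  have hr' : (1 : ℝ) ≤ r := by exact_mod_cast hr
  have hL' : (1 : ℝ) ≤ L := by exact_mod_cast hL
  have hlog : 0 ≤ Real.log n := Real.log_nonneg (by linarith)
  calc Real.log (2 * B * ((2 * r * B) ^ L * (n : ℝ) ^ 2))
      ≤ Real.log (n * n * ((n * n * n : ℝ) ^ L * (n : ℝ) ^ 2)) := by
        refine Real.log_le_log (by positivity) ?_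
        gcongr
    _ = (4 + 3 * L) * Real.log n := by
        have hn0 : (n : ℝ) ≠ 0 := by positivity
        rw [show (n * n * ((n * n * n : ℝ) ^ L * (n : ℝ) ^ 2)) = (n : ℝ) ^ (4 + 3 * L) by ring,
          Real.log_pow]
        push_cast
        ring
    _ ≤ _ := by nlinarith

theorem IsLargeSample.one_le_complexity (hn : IsLargeSample n p L r B K) (hL : 1 ≤ L) :
    1 / 2 ≤ numParams p L r * L * Real.log n := by
  have h1 := hn.half_le_log
  have h2 : (1 : ℝ) ≤ numParams p L r := by
    exact_mod_cast one_le_numParams (p := p) (L := L) (r := r)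
  have h3 : (1 : ℝ) ≤ L := by exact_mod_cast hL
  have h4 : (1 : ℝ) ≤ numParams p L r * L := one_le_mul_of_one_le_of_one_le h2 h3
  nlinarith

theorem sq_pow_mul_inv {x y : ℝ} (hx : x ≠ 0) (L : ℕ) : x ^ L * ((x ^ L)⁻¹ * y) = y := by
  have := pow_ne_zero L hx
  field_simp

/-- The logarithm of the bound of the exponential moment, on the scale of the excess risk. -/
theorem log_bound_div_le (hΞ0 : 0 < Ξ) (hK : 1 ≤ K) (hB : 1 ≤ B) (hL : 1 ≤ L)
    (hr : 1 ≤ r) (hn : IsLargeSample n p L r B K) {δ R ℓ : ℝ} (hδ : 0 < δ) :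
    (Real.log (4 / δ ^ 2 * Real.exp (n * (3 / (2 * Ξ) * (2 * R + 32 * p * K *
      ((2 * r * B) ^ L * (((2 * r * B) ^ L)⁻¹ * ((n : ℝ) ^ 2)⁻¹)) ^ 2))) * 1
        / (((2 * r * B) ^ L)⁻¹ * ((n : ℝ) ^ 2)⁻¹ / (2 * B)) ^ numParams p L r) + ℓ)
          / (n * (1 / (4 * Ξ)))
      ≤ 12 * R + (28 * Ξ + 192) / n * (numParams p L r * L * Real.log n)
        + 4 * Ξ / n * (2 * Real.log (2 / δ) + ℓ) := by
  have h2 : (2 : ℝ) ≤ n := by exact_mod_cast hn.1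
  have hn0 : (0 : ℝ) < n := by linarith
  have hr' : (1 : ℝ) ≤ r := by exact_mod_cast hr
  have hlog := hn.log_cube_le hB hL hr
  have hcomp := hn.one_le_complexity hL
  have hpn : (p : ℝ) ≤ n := by exact_mod_cast hn.2.2.2.2.2
  have hKn : K ≤ n := hn.2.2.1
  rw [sq_pow_mul_inv (by positivity)]
  set V := 2 * R + 32 * p * K * (((n : ℝ) ^ 2)⁻¹) ^ 2 with hV
  -- The radius `n⁻²` (up to the Lipschitz scale) makes the approximation term `32 p K n⁻⁴`. As `p,
  -- K ≤ n`, it is at most `32/n²` and is absorbed by the complexity, which is at least `1/2`; `192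
  -- = 6 · 32`.
  have hVle : 6 * V ≤ 12 * R + 192 / n * (numParams p L r * L * Real.log n) := by
    have h3 : (p : ℝ) * K ≤ n * n := by gcongr
    have h4 : (p : ℝ) * K * (((n : ℝ) ^ 2)⁻¹) ^ 2 ≤ 1 / n * (1 / 2) := by
      calc _ ≤ (n : ℝ) * n * (((n : ℝ) ^ 2)⁻¹) ^ 2 := by gcongr
        _ = 1 / n * (1 / n) := by field_simp
        _ ≤ _ := by gcongr
    have h5 : 1 / (n : ℝ) * (1 / 2) ≤ 1 / n * (numParams p L r * L * Real.log n) := by gcongr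
    have h6 : 192 / (n : ℝ) * (numParams p L r * L * Real.log n)
      = 192 * (1 / n * (numParams p L r * L * Real.log n)) := by ring
    rw [hV, h6]
    linarith
  have hlogq : Real.log (4 / δ ^ 2 * Real.exp (n * (3 / (2 * Ξ) * V)) * 1
        / (((2 * r * B) ^ L)⁻¹ * ((n : ℝ) ^ 2)⁻¹ / (2 * B)) ^ numParams p L r)
      = 2 * Real.log (2 / δ) + n * (3 / (2 * Ξ) * V)
        + numParams p L r * Real.log (2 * B * ((2 * r * B) ^ L * (n : ℝ) ^ 2)) := by
    rw [show ((2 * r * B) ^ L)⁻¹ * ((n : ℝ) ^ 2)⁻¹ / (2 * B)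
      = (2 * B * ((2 * r * B) ^ L * (n : ℝ) ^ 2))⁻¹ by field_simp, inv_pow, div_inv_eq_mul, mul_one,
      show (4 : ℝ) / δ ^ 2 = (2 / δ) ^ 2 by ring, Real.log_mul (by positivity) (by positivity),
      Real.log_mul (by positivity) (by positivity), Real.log_exp, Real.log_pow, Real.log_pow]
    push_cast
    ring
  rw [hlogq]
  calc _ = 6 * V + 4 * Ξ / n * (2 * Real.log (2 / δ) + ℓ) + 4 * Ξ / n * (numParams p L r *
        Real.log (2 * B * ((2 * r * B) ^ L * (n : ℝ) ^ 2))) := by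
        field_simp
        ring
    _ ≤ (12 * R + 192 / n * (numParams p L r * L * Real.log n))
        + 4 * Ξ / n * (2 * Real.log (2 / δ) + ℓ)
        + 4 * Ξ / n * (numParams p L r * (7 * (L * Real.log n))) := by gcongr
    _ = _ := by ring

/-- The oracle inequality, uniformly over an event of probability at least `1 - δ`. -/
theorem IsBoundedRegression.exists_oracle_event (H : IsBoundedRegression P X Y f C K σ Γ)
    (hD : IsSample P X Y D) (hΞ : IsTemperature C σ Γ Ξ) (hK : 1 ≤ K) (hB : 1 ≤ B) (hρ : 0 < ρ)
    (hρ1 : ρ ≤ 1) (hp : 1 ≤ p) (hL : 1 ≤ L) (hr : 1 ≤ r) (hn : IsLargeSample n p L r B K)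
    (hθs : θs ∈ cube p L r B) {δ : ℝ} (hδ : 0 < δ) :
    ∃ G : Set (Fin n → EuclideanSpace ℝ (Fin p) × ℝ), MeasurableSet G ∧
      ENNReal.ofReal (1 - δ) ≤ (P.map fun ω i => D i ω) G ∧
      ∀ d ∈ G, (∀ η : ℝ, 0 < η → surrogatePosterior L r C B (n / Ξ) ρ d
          {θ | sqDist (P.map X) f (clipped C θ) ≤ 12 * sqDist (P.map X) f (clipped C θs)
            + (28 * Ξ + 192) / n * (numParams p L r * L * Real.log n)
            + 4 * Ξ / n * (2 * Real.log (2 / δ) + Real.log (1 / η))}ᶜ ≤ ENNReal.ofReal η) ∧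
        sqDist (P.map X) f (posteriorMean L r C B (n / Ξ) ρ d) ≤
          12 * sqDist (P.map X) f (clipped C θs)
            + (28 * Ξ + 192) / n * (numParams p L r * L * Real.log n)
            + 4 * Ξ / n * (2 * Real.log (2 / δ)) := by
  have hB0 : 0 < B := by linarith
  have hΞ0 := hΞ.pos
  have hn1 : n ≠ 0 := by have := hn.1; omega
  have h2 : (2 : ℝ) ≤ n := by exact_mod_cast hn.1
  have hr' : (1 : ℝ) ≤ r := by exact_mod_cast hr
  have hx : 1 ≤ 2 * r * B := by nlinarith
  have hu1 : ((2 * r * B) ^ L)⁻¹ * ((n : ℝ) ^ 2)⁻¹ ≤ 2 * B := by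
    have h3 : ((2 * r * B) ^ L)⁻¹ ≤ 1 := inv_le_one_of_one_le₀ (one_le_pow₀ hx)
    have h4 : ((n : ℝ) ^ 2)⁻¹ ≤ 1 := inv_le_one_of_one_le₀ (one_le_pow₀ (by linarith))
    calc _ ≤ (1 : ℝ) * 1 := by gcongr
      _ ≤ _ := by linarith
  have hs := H.measurable_sqDist_clipped (L := L) (r := r)
  have := isProbabilityMeasure_prior (p := p) (L := L) (r := r) hB0
  have := H.isProbabilityMeasure_map
  have ht : 0 < n * (1 / (4 * Ξ)) := by positivity
  -- The exponential `k` cancels the decay factor exactly, so `J = 1`. The event does not involve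
  -- `η`, so a single one serves all tail levels and the posterior mean.
  obtain ⟨G, hG, hGP, hGk⟩ := H.exists_event hD hΞ hK hB hρ hρ1 hp hL hr hn1 hθs
    (u := ((2 * r * B) ^ L)⁻¹ * ((n : ℝ) ^ 2)⁻¹) (by positivity) hu1
    (k := fun θ => ENNReal.ofReal
      (Real.exp (n * (1 / (4 * Ξ)) * sqDist (P.map X) f (clipped C θ))))
    (by fun_prop) one_pos (by
      refine le_trans (lintegral_mono (g := fun _ => 1) fun θ => le_of_eq ?_) (by simp)
      rw [← ENNReal.ofReal_mul (by positivity), ← Real.exp_add]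
      simp [mul_assoc]) hδ
  refine ⟨G, hG, hGP, fun d hd => ⟨fun η hη => ?_, ?_⟩⟩
  · refine le_trans (measure_mono ?_) (measure_not_le_of_lintegral_exp_le hs ht (by positivity)
      hη (hGk d hd))
    rw [Set.compl_subset_compl]
    exact fun θ hθ => le_trans hθ (log_bound_div_le hΞ0 hK hB hL hr hn hδ)
  · have := isProbabilityMeasure_surrogatePosterior (C := C) (L := L) (r := r) hn1 hΞ0 hB0 hρ hρ1 d
    have hi : Integrable (fun θ : Param p L r => sqDist (P.map X) f (clipped C θ))
        (surrogatePosterior L r C B (n / Ξ) ρ d) := by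
      refine Integrable.of_bound hs.aestronglyMeasurable ((2 * C) ^ 2) (ae_of_all _ fun θ => ?_)
      rw [Real.norm_eq_abs, abs_of_nonneg (sqDist_nonneg _ _ _)]
      exact sqDist_le H.measurable_f (measurable_clipped C θ) H.bounded
        (abs_clipped_le hΞ.C_pos.le θ)
    have h1 := integral_le_of_lintegral_exp_le hs hi ht (by positivity) (hGk d hd)
    have h3 := log_bound_div_le (ℓ := 0) (R := sqDist (P.map X) f (clipped C θs)) hΞ0 hK hB hL hr
      hn hδ
    rw [add_zero, add_zero] at h3
    exact (sqDist_integral_le H.measurable_f H.bounded (measurable_clipped_uncurry C)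
      (abs_clipped_le hΞ.C_pos.le)).trans (h1.trans h3)

/-- Parameter balls around the origin have small posterior mass. -/
theorem IsBoundedRegression.exists_small_ball_event (H : IsBoundedRegression P X Y f C K σ Γ)
    (hD : IsSample P X Y D) (hΞ : IsTemperature C σ Γ Ξ) (hK : 1 ≤ K) (hB : 1 ≤ B) (hρ : 0 < ρ)
    (hρ1 : ρ ≤ 1) (hp : 1 ≤ p) (hL : 1 ≤ L) (hr : 1 ≤ r) (hn : IsLargeSample n p L r B K)
    (hθs : θs ∈ cube p L r B) {A : ℝ}
    (hA : sqDist (P.map X) f (clipped C θs) ≤ A * Ξ * numParams p L r / n)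
    {δ η ζ : ℝ} (hδ : 0 < δ) (hζ : 0 < ζ)
    (hζη : 4 / δ ^ 2 * (2 * ζ * Real.exp (3 * A + 48 * p * K / Ξ)) ≤ η)
    (hζ1 : 2 * ζ * Real.exp (3 * A + 48 * p * K / Ξ) ≤ 1) :
    ∃ G : Set (Fin n → EuclideanSpace ℝ (Fin p) × ℝ), MeasurableSet G ∧
      ENNReal.ofReal (1 - δ) ≤ (P.map fun ω i => D i ω) G ∧
      ∀ d ∈ G, surrogatePosterior L r C B (n / Ξ) ρ d
          {θ | ‖θ‖ ≤ ((2 * (r : ℝ) * B) ^ L)⁻¹ * (ζ * √(numParams p L r / n))}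
        ≤ ENNReal.ofReal η := by
  have hB0 : 0 < B := by linarith
  have hΞ0 := hΞ.pos
  have hn1 : n ≠ 0 := by have := hn.1; omega
  have hn0 : (0 : ℝ) < n := by positivity
  have hP1 : (1 : ℝ) ≤ numParams p L r := by
    exact_mod_cast one_le_numParams (p := p) (L := L) (r := r)
  have hr' : (1 : ℝ) ≤ r := by exact_mod_cast hr
  have hpn : (p : ℝ) ≤ n := by exact_mod_cast hn.2.2.2.2.2
  have hx : 1 ≤ 2 * r * B := by nlinarith
  set y := √(numParams p L r / n) with hy
  have hy0 : 0 < y := Real.sqrt_pos.2 (by positivity)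
  have hysq : y ^ 2 = numParams p L r / n := Real.sq_sqrt (by positivity)
  have := isProbabilityMeasure_prior (p := p) (L := L) (r := r) hB0
  -- The admissible radius: `p ≤ n` gives `P/n ≤ 4 L r²`, and `L ≤ (2^L)²`, `r ≤ (rB)^L` give `y ≤ 2
  -- (2rB)^L`.
  have hu1 : ((2 * r * B) ^ L)⁻¹ * y ≤ 2 * B := by
    have h1 : (numParams p L r : ℝ) ≤ 4 * p * L * r ^ 2 := by
      exact_mod_cast numParams_le hp hL hr
    have h2 : y ^ 2 ≤ 4 * (L * r ^ 2) := by
      rw [hysq, div_le_iff₀ hn0]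
      calc (numParams p L r : ℝ) ≤ p * (4 * (L * r ^ 2)) := by linarith
        _ ≤ n * (4 * (L * r ^ 2)) := by gcongr
        _ = _ := by ring
    have h3 : (L : ℝ) ≤ (2 ^ L) ^ 2 := by
      have h4 : (L : ℝ) ≤ 2 ^ L := by exact_mod_cast L.lt_two_pow_self.le
      nlinarith [one_le_pow₀ (one_le_two (α := ℝ)) (n := L)]
    have h5 : (r : ℝ) ≤ (r * B) ^ L := by
      calc (r : ℝ) = (r * 1) ^ 1 := by ring
        _ ≤ (r * B) ^ 1 := by gcongr
        _ ≤ (r * B) ^ L := pow_le_pow_right₀ (by nlinarith) hL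
    have h6 : y ≤ 2 * (2 * r * B) ^ L := by
      refine abs_le_of_sq_le_sq' (h2.trans ?_) (by positivity) |>.2
      calc 4 * (L * (r : ℝ) ^ 2) ≤ 4 * ((2 ^ L) ^ 2 * ((r * B) ^ L) ^ 2) := by gcongr
        _ = _ := by
          rw [mul_assoc 2 (r : ℝ) B, mul_pow 2 (r * B)]
          ring
    rw [inv_mul_le_iff₀ (by positivity)]
    nlinarith [pow_pos (show 0 < 2 * r * B by linarith) L]
  obtain ⟨G, hG, hGP, hGk⟩ := H.exists_event hD hΞ hK hB hρ hρ1 hp hL hr hn1 hθs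
    (u := ((2 * r * B) ^ L)⁻¹ * y) (by positivity) hu1
    (k := {θ | ‖θ‖ ≤ ((2 * (r : ℝ) * B) ^ L)⁻¹ * (ζ * y)}.indicator 1)
    (measurable_one.indicator (measurableSet_le measurable_norm measurable_const))
    (J := (((2 * (r : ℝ) * B) ^ L)⁻¹ * (ζ * y) / B) ^ numParams p L r) (by positivity) (by
      refine le_trans ?_ (prior_closedBall_le hB0 (by positivity))
      rw [← lintegral_indicator_one (measurableSet_le measurable_norm measurable_const)]
      refine lintegral_mono fun θ => mul_le_of_le_one_right' ?_
      rw [← ENNReal.ofReal_one]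
      refine ENNReal.ofReal_le_ofReal (Real.exp_le_one_iff.2 (neg_nonpos.2 ?_))
      have := sqDist_nonneg (P.map X) f (clipped C θ)
      positivity) hδ
  refine ⟨G, hG, hGP, fun d hd => ?_⟩
  have h1 := hGk d hd
  rw [lintegral_indicator_one (measurableSet_le measurable_norm measurable_const)] at h1
  refine h1.trans (ENNReal.ofReal_le_ofReal (le_trans ?_ hζη))
  rw [sq_pow_mul_inv (by positivity), hysq]
  set c := 3 * A + 48 * p * K / Ξ with hc
  -- At radius `(2rB)^(-L) √(P/n)` the approximation error and the assumed oracle risk are both of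
  -- order `P/n`, without a logarithm. The cost is therefore `exp (cP)`, of the same form as the
  -- prior mass ratio `(2ζ)^P`.
  have h3 : n * (3 / (2 * Ξ) * (2 * sqDist (P.map X) f (clipped C θs)
      + 32 * p * K * (numParams p L r / n))) ≤ numParams p L r * c := by
    calc _ ≤ n * (3 / (2 * Ξ) * (2 * (A * Ξ * numParams p L r / n)
          + 32 * p * K * (numParams p L r / n))) := by gcongr
      _ = _ := by
        rw [hc]
        field_simp
        ring
  have h4 : Real.exp (n * (3 / (2 * Ξ) * (2 * sqDist (P.map X) f (clipped C θs)
      + 32 * p * K * (numParams p L r / n)))) ≤ Real.exp c ^ numParams p L r := by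
    rw [← Real.exp_nat_mul]
    gcongr
  calc _ ≤ 4 / δ ^ 2 * Real.exp c ^ numParams p L r
        * (((2 * (r : ℝ) * B) ^ L)⁻¹ * (ζ * y) / B) ^ numParams p L r
          / (((2 * r * B) ^ L)⁻¹ * y / (2 * B)) ^ numParams p L r := by gcongr
    _ = 4 / δ ^ 2 * (2 * ζ * Real.exp c) ^ numParams p L r := by
        rw [mul_assoc, mul_div_assoc, ← mul_pow, ← div_pow]
        congr 2
        field_simp
    -- Since the base is at most 1 and `P ≥ 1`, the power can be dropped, so `ζ` need not depend on
    -- `P`.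
    _ ≤ 4 / δ ^ 2 * (2 * ζ * Real.exp c) := by
        gcongr
        exact pow_le_of_le_one (by positivity) hζ1 (by
          have := one_le_numParams (p := p) (L := L) (r := r)
          omega)

end Oracle

/-! ### Norms and credible balls -/

section Norms

variable {p : ℕ} {μ : Measure (EuclideanSpace ℝ (Fin p))}
  {f h : EuclideanSpace ℝ (Fin p) → ℝ} {C : ℝ}

theorem memLp_two_of_bounded [IsFiniteMeasure μ] (hf : Measurable f) (hfC : ∀ᵐ x ∂μ, |f x| ≤ C) : MemLp f 2 μ :=
  MemLp.of_bound hf.aestronglyMeasurable C hfC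

theorem sq_l2Norm_sub (hfh : MemLp (fun x => h x - f x) 2 μ) :
    l2Norm μ (fun x => h x - f x) ^ 2 = sqDist μ f h := by
  unfold l2Norm sqDist
  rw [hfh.eLpNorm_eq_integral_rpow_norm (by simp) (by simp),
    ENNReal.toReal_ofReal (by positivity), ← Real.rpow_natCast, ← Real.rpow_mul (by positivity)]
  simp

theorem l2Norm_nonneg (h : EuclideanSpace ℝ (Fin p) → ℝ) : 0 ≤ l2Norm μ h :=
  ENNReal.toReal_nonneg

theorem sqDist_comm (μ : Measure (EuclideanSpace ℝ (Fin p)))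
    (f h : EuclideanSpace ℝ (Fin p) → ℝ) : sqDist μ f h = sqDist μ h f :=
  integral_congr_ae (ae_of_all _ fun x => by ring)

theorem sqDist_le_two_mul {g : EuclideanSpace ℝ (Fin p) → ℝ} (hf : MemLp f 2 μ) (hg : MemLp g 2 μ)
    (hh : MemLp h 2 μ) : sqDist μ g h ≤ 2 * sqDist μ f h + 2 * sqDist μ f g := by
  have h1 : Integrable (fun x => (h x - g x) ^ 2) μ := (hh.sub hg).integrable_sq
  have h2 : Integrable (fun x => (h x - f x) ^ 2) μ := (hh.sub hf).integrable_sq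
  have h3 : Integrable (fun x => (g x - f x) ^ 2) μ := (hg.sub hf).integrable_sq
  unfold sqDist
  rw [← integral_const_mul, ← integral_const_mul, ← integral_add (h2.const_mul 2) (h3.const_mul 2)]
  refine integral_mono h1 ((h2.const_mul 2).add (h3.const_mul 2)) fun x => ?_
  simp only
  nlinarith [sq_nonneg ((h x - f x) + (g x - f x))]

theorem l2Diam_l2Ball_le (hf : MemLp f 2 μ) {τ : ℝ} :
    l2Diam μ (l2Ball μ f τ) ≤ ENNReal.ofReal (2 * τ) := by
  refine iSup₂_le fun g hg => iSup₂_le fun h hh => ?_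
  have key : ∀ g ∈ l2Ball μ f τ, eLpNorm (fun x => g x - f x) 2 μ ≤ ENNReal.ofReal τ :=
    fun g hg => by
      have hgf : MemLp (fun x => g x - f x) 2 μ := hg.1.sub hf
      -- Membership in L² is essential: it rules out an infinite norm, which `toReal` would send to
      -- 0.
      rw [← ENNReal.ofReal_toReal hgf.eLpNorm_ne_top]
      exact ENNReal.ofReal_le_ofReal hg.2
  have hτ : 0 ≤ τ := (l2Norm_nonneg _).trans hg.2
  calc eLpNorm (fun x => g x - h x) 2 μ
      = eLpNorm ((fun x => g x - f x) - fun x => h x - f x) 2 μ := by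
        congr 1
        ext x
        simp
    _ ≤ eLpNorm (fun x => g x - f x) 2 μ + eLpNorm (fun x => h x - f x) 2 μ :=
        eLpNorm_sub_le (hg.1.sub hf).1 (hh.1.sub hf).1 (by norm_num)
    _ ≤ ENNReal.ofReal τ + ENNReal.ofReal τ := add_le_add (key g hg) (key h hh)
    _ = _ := by rw [← ENNReal.ofReal_add hτ hτ, two_mul]

end Norms

/-! ### Transfer and intersection of events of high probability -/

theorem ofReal_one_sub_le_of_compl {T : Type*} [MeasurableSpace T] {π : Measure T}
    [IsProbabilityMeasure π] {S : Set T} {η : ℝ} (hη : 0 ≤ η) (h : π Sᶜ ≤ ENNReal.ofReal η) :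
    ENNReal.ofReal (1 - η) ≤ π S := by
  rw [ENNReal.ofReal_sub _ hη, ENNReal.ofReal_one, tsub_le_iff_right, ← measure_univ (μ := π),
    ← Set.union_compl_self S]
  exact (measure_union_le _ _).trans (by gcongr)

/-- Only the event `G` on the data has to be measurable; monotonicity of the outer measure then
covers sets `S` defined through critical values. -/
theorem le_measure_of_le_map {Ω E : Type*} [MeasurableSpace Ω] [MeasurableSpace E] {P : Measure Ω}
    {D : Ω → E} (hD : AEMeasurable D P) {G : Set E} (hG : MeasurableSet G) {c : ℝ≥0∞}
    (hc : c ≤ P.map D G) {S : Set Ω} (hS : ∀ ω, D ω ∈ G → ω ∈ S) : c ≤ P S := by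
  rw [Measure.map_apply_of_aemeasurable hD hG] at hc
  exact hc.trans (measure_mono hS)

theorem one_sub_le_measure_inter {E : Type*} [MeasurableSpace E] {π : Measure E}
    [IsProbabilityMeasure π] {G₁ G₂ : Set E} (h₁ : MeasurableSet G₁) (h₂ : MeasurableSet G₂)
    {δ : ℝ} (hδ : 0 ≤ δ) (hG₁ : ENNReal.ofReal (1 - δ / 2) ≤ π G₁)
    (hG₂ : ENNReal.ofReal (1 - δ / 2) ≤ π G₂) : ENNReal.ofReal (1 - δ) ≤ π (G₁ ∩ G₂) := by
  have key : ∀ {G : Set E}, MeasurableSet G → ENNReal.ofReal (1 - δ / 2) ≤ π G →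
      π Gᶜ ≤ ENNReal.ofReal (δ / 2) := fun {G} hG h => by
    rw [prob_compl_eq_one_sub hG, tsub_le_iff_right]
    calc (1 : ℝ≥0∞) = ENNReal.ofReal (δ / 2 + (1 - δ / 2)) := by simp
      _ ≤ ENNReal.ofReal (δ / 2) + ENNReal.ofReal (1 - δ / 2) := ENNReal.ofReal_add_le
      _ ≤ _ := by gcongr
  refine ofReal_one_sub_le_of_compl hδ ?_
  rw [Set.compl_inter]
  refine (measure_union_le _ _).trans ?_
  calc _ ≤ ENNReal.ofReal (δ / 2) + ENNReal.ofReal (δ / 2) := add_le_add (key h₁ hG₁) (key h₂ hG₂)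
    _ = ENNReal.ofReal δ := by
      rw [← ENNReal.ofReal_add (by positivity) (by positivity), add_halves]

/-! ### Oracle inequalities, diameter and coverage -/

section Main

variable {p L r : ℕ} {Ω : Type*} [MeasurableSpace Ω] {P : Measure Ω} [IsProbabilityMeasure P]
  {X : Ω → EuclideanSpace ℝ (Fin p)} {Y : Ω → ℝ} {f : EuclideanSpace ℝ (Fin p) → ℝ}
  {C K σ Γ Ξ Ξ' B ρ : ℝ} {n : ℕ} {D : Fin n → Ω → EuclideanSpace ℝ (Fin p) × ℝ}
  {θs : Param p L r}

theorem measurable_posteriorMean (hn : n ≠ 0) (hΞ : 0 < Ξ) (hB : 0 < B) (hρ : 0 < ρ) (hρ1 : ρ ≤ 1)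
    (d : Fin n → EuclideanSpace ℝ (Fin p) × ℝ) :
    Measurable (posteriorMean L r C B (n / Ξ) ρ d) := by
  have := isProbabilityMeasure_surrogatePosterior (C := C) (L := L) (r := r) hn hΞ hB hρ hρ1 d
  exact (measurable_clipped_uncurry C).stronglyMeasurable.integral_prod_left.measurable

theorem abs_posteriorMean_le (hC : 0 ≤ C) (hn : n ≠ 0) (hΞ : 0 < Ξ) (hB : 0 < B) (hρ : 0 < ρ)
    (hρ1 : ρ ≤ 1) (d : Fin n → EuclideanSpace ℝ (Fin p) × ℝ) (x : EuclideanSpace ℝ (Fin p)) :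
    |posteriorMean L r C B (n / Ξ) ρ d x| ≤ C := by
  have := isProbabilityMeasure_surrogatePosterior (C := C) (L := L) (r := r) hn hΞ hB hρ hρ1 d
  have h := norm_integral_le_of_norm_le_const (μ := surrogatePosterior L r C B (n / Ξ) ρ d)
    (f := fun θ => clipped C θ x) (ae_of_all _ fun θ => abs_clipped_le hC θ x)
  simpa [posteriorMean] using h

theorem surrogatePosterior_closedBall (hn : n ≠ 0) (hΞ : 0 < Ξ) (hB : 0 < B) (hρ : 0 < ρ)
    (hρ1 : ρ ≤ 1) (d : Fin n → EuclideanSpace ℝ (Fin p) × ℝ) :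
    (surrogatePosterior L r C B (n / Ξ) ρ d).real {θ | ‖θ‖ ≤ B} = 1 := by
  have := isProbabilityMeasure_surrogatePosterior (C := C) (L := L) (r := r) hn hΞ hB hρ hρ1 d
  have hm : MeasurableSet {θ : Param p L r | ‖θ‖ ≤ B} :=
    measurableSet_le measurable_norm measurable_const
  have h0 : prior p L r B {θ | ‖θ‖ ≤ B}ᶜ = 0 := by
    have : cube p L r B ∩ {θ | ‖θ‖ ≤ B}ᶜ = ∅ := by
      rw [Set.eq_empty_iff_forall_notMem]
      exact fun θ hθ => hθ.2 ((pi_norm_le_iff_of_nonneg hB.le).2 fun i => abs_le_of_mem_cube hθ.1 i)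
    rw [prior_apply hB, this, measure_empty, ENNReal.zero_div]
  have h1 : surrogatePosterior L r C B (n / Ξ) ρ d {θ | ‖θ‖ ≤ B}ᶜ = 0 :=
    tilted_absolutelyContinuous _ _ h0
  rw [measureReal_def, (prob_compl_eq_zero_iff hm).1 h1, ENNReal.toReal_one]

theorem log_two_div_half_le {δ : ℝ} (hδ : 0 < δ) (hδ1 : δ ≤ 1) :
    Real.log (2 / (δ / 2)) ≤ 2 * Real.log (2 / δ) := by
  rw [show 2 * Real.log (2 / δ) = Real.log ((2 / δ) ^ 2) by simp [Real.log_pow]]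
  refine Real.log_le_log (by positivity) ?_
  rw [div_pow, div_div_eq_mul_div, div_le_div_iff₀ hδ (by positivity)]
  nlinarith

theorem log_two_div_nonneg {δ : ℝ} (hδ : 0 < δ) (hδ1 : δ ≤ 1) : 0 ≤ Real.log (2 / δ) :=
  Real.log_nonneg (by rw [le_div_iff₀ hδ]; linarith)

/-- The oracle inequality for a draw from the surrogate posterior. -/
theorem IsBoundedRegression.oracle_draw (H : IsBoundedRegression P X Y f C K σ Γ)
    (hD : IsSample P X Y D) (hΞ : IsTemperature C σ Γ Ξ) (hK : 1 ≤ K) (hB : 1 ≤ B) (hρ : 0 < ρ)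
    (hρ1 : ρ ≤ 1) (hp : 1 ≤ p) (hL : 1 ≤ L) (hr : 1 ≤ r) (hn : IsLargeSample n p L r B K)
    (hθs : θs ∈ cube p L r B) (hΞ' : 28 * Ξ + 192 ≤ Ξ') {δ : ℝ} (hδ : 0 < δ) (hδ1 : δ < 1) :
    ENNReal.ofReal (1 - δ) ≤ ∫⁻ ω, surrogatePosterior L r C B (n / Ξ) ρ (fun i => D i ω)
      {θ | excessRisk P X Y f (clipped C θ) ≤ 12 * excessRisk P X Y f (clipped C θs)
        + Ξ' / n * (numParams p L r * L * Real.log n + Real.log (2 / δ))} ∂P := by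
  have hC0 := hΞ.C_pos.le
  have hΞ0 := hΞ.pos
  have hB0 : 0 < B := by linarith
  have hn1 : n ≠ 0 := by have := hn.1; omega
  have hcomp := hn.one_le_complexity hL
  simp_rw [fun θ : Param p L r => H.excessRisk_eq (measurable_clipped C θ) (abs_clipped_le hC0 θ)]
  obtain ⟨G, hG, hGP, hGk⟩ := H.exists_oracle_event hD hΞ hK hB hρ hρ1 hp hL hr hn hθs
    (half_pos hδ)
  have hl := log_two_div_half_le hδ hδ1.le
  have hl0 := log_two_div_nonneg hδ hδ1.le
  -- The level `δ` is split evenly between data and draw, and `(1 - δ/2)² ≥ 1 - δ`. A lower bound by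
  -- a measurable indicator avoids measurability of the posterior mass in `ω`.
  have hpt : ∀ ω, G.indicator (fun _ => ENNReal.ofReal (1 - δ / 2)) (fun i => D i ω) ≤
      surrogatePosterior L r C B (n / Ξ) ρ (fun i => D i ω)
        {θ | sqDist (P.map X) f (clipped C θ) ≤ 12 * sqDist (P.map X) f (clipped C θs)
          + Ξ' / n * (numParams p L r * L * Real.log n + Real.log (2 / δ))} := by
    intro ω
    by_cases hω : (fun i => D i ω) ∈ G
    · rw [Set.indicator_of_mem hω]
      have := isProbabilityMeasure_surrogatePosterior (C := C) (L := L) (r := r) hn1 hΞ0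
        hB0 hρ hρ1 (fun i => D i ω)
      refine (ofReal_one_sub_le_of_compl (half_pos hδ).le
        ((hGk _ hω).1 (δ / 2) (half_pos hδ))).trans (measure_mono fun θ hθ => ?_)
      refine le_trans (Set.mem_ofPred_eq ▸ hθ) ?_
      rw [show 1 / (δ / 2) = 2 / δ by field_simp]
      calc _ ≤ 12 * sqDist (P.map X) f (clipped C θs)
            + (28 * Ξ + 192) / n * (numParams p L r * L * Real.log n)
            + 4 * Ξ / n * (2 * (2 * Real.log (2 / δ)) + Real.log (2 / δ)) := by gcongr
        _ = 12 * sqDist (P.map X) f (clipped C θs)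
            + (28 * Ξ + 192) / n * (numParams p L r * L * Real.log n)
            + 20 * Ξ / n * Real.log (2 / δ) := by ring
        _ ≤ 12 * sqDist (P.map X) f (clipped C θs) + Ξ' / n * (numParams p L r * L * Real.log n)
            + Ξ' / n * Real.log (2 / δ) := by
          gcongr
          linarith
        _ = _ := by ring
    · rw [Set.indicator_of_notMem hω]
      exact zero_le
  calc ENNReal.ofReal (1 - δ) ≤ ENNReal.ofReal (1 - δ / 2) * ENNReal.ofReal (1 - δ / 2) := by
        rw [← ENNReal.ofReal_mul (by linarith)]
        exact ENNReal.ofReal_le_ofReal (by nlinarith)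
    _ ≤ ENNReal.ofReal (1 - δ / 2) * (P.map fun ω i => D i ω) G := by gcongr
    _ = ∫⁻ ω, G.indicator (fun _ => ENNReal.ofReal (1 - δ / 2)) (fun i => D i ω) ∂P := by
        rw [← lintegral_indicator_const hG, lintegral_map' (measurable_const.indicator hG).aemeasurable
          hD.aemeasurable]
    _ ≤ _ := lintegral_mono hpt

/-- The oracle inequality for the posterior mean. -/
theorem IsBoundedRegression.oracle_mean (H : IsBoundedRegression P X Y f C K σ Γ)
    (hD : IsSample P X Y D) (hΞ : IsTemperature C σ Γ Ξ) (hK : 1 ≤ K) (hB : 1 ≤ B) (hρ : 0 < ρ)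
    (hρ1 : ρ ≤ 1) (hp : 1 ≤ p) (hL : 1 ≤ L) (hr : 1 ≤ r) (hn : IsLargeSample n p L r B K)
    (hθs : θs ∈ cube p L r B) (hΞ' : 28 * Ξ + 192 ≤ Ξ') {δ : ℝ} (hδ : 0 < δ) (hδ1 : δ < 1) :
    ENNReal.ofReal (1 - δ) ≤ P {ω | excessRisk P X Y f
      (posteriorMean L r C B (n / Ξ) ρ (fun i => D i ω)) ≤ 12 * excessRisk P X Y f (clipped C θs)
        + Ξ' / n * (numParams p L r * L * Real.log n + Real.log (2 / δ))} := by
  have hC0 := hΞ.C_pos.le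
  have hΞ0 := hΞ.pos
  have hB0 : 0 < B := by linarith
  have hn1 : n ≠ 0 := by have := hn.1; omega
  have hcomp := hn.one_le_complexity hL
  have hl0 := log_two_div_nonneg hδ hδ1.le
  obtain ⟨G, hG, hGP, hGk⟩ := H.exists_oracle_event hD hΞ hK hB hρ hρ1 hp hL hr hn hθs hδ
  refine le_measure_of_le_map hD.aemeasurable hG hGP fun ω hω => ?_
  rw [Set.mem_ofPred_eq, H.excessRisk_eq (measurable_clipped C θs) (abs_clipped_le hC0 θs),
    H.excessRisk_eq (measurable_posteriorMean hn1 hΞ0 hB0 hρ hρ1 _)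
      (abs_posteriorMean_le hC0 hn1 hΞ0 hB0 hρ hρ1 _)]
  calc _ ≤ _ := (hGk _ hω).2
    _ = 12 * sqDist (P.map X) f (clipped C θs)
        + (28 * Ξ + 192) / n * (numParams p L r * L * Real.log n)
        + 8 * Ξ / n * Real.log (2 / δ) := by ring
    _ ≤ 12 * sqDist (P.map X) f (clipped C θs) + Ξ' / n * (numParams p L r * L * Real.log n)
        + Ξ' / n * Real.log (2 / δ) := by
      gcongr
      linarith
    _ = _ := by ring

/-- The diameter of the credible ball. -/
theorem IsBoundedRegression.diam_credibleBall_le (H : IsBoundedRegression P X Y f C K σ Γ)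
    (hD : IsSample P X Y D) (hΞ : IsTemperature C σ Γ Ξ) (hK : 1 ≤ K) (hB : 1 ≤ B) (hρ : 0 < ρ)
    (hρ1 : ρ ≤ 1) (hp : 1 ≤ p) (hL : 1 ≤ L) (hr : 1 ≤ r) (hn : IsLargeSample n p L r B K)
    (hθs : θs ∈ cube p L r B) (hΞ' : 28 * Ξ + 192 ≤ Ξ') {α : ℝ} (hα : 0 < α) (hα1 : α < 1) :
    ENNReal.ofReal (1 - α) ≤ P {ω | l2Diam (P.map X)
      (credibleBall L r C B (n / Ξ) ρ (P.map X) (fun i => D i ω)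
        (criticalValue L r C B (n / Ξ) ρ (P.map X) (fun i => D i ω) α)) ≤
      ENNReal.ofReal (4 * √(2 * rateSq C Ξ' n (P.map X) f θs
        + 4 * Ξ' / n * Real.log (2 / α)))} := by
  have hC0 := hΞ.C_pos.le
  have hΞ0 := hΞ.pos
  have hB0 : 0 < B := by linarith
  have hn1 : n ≠ 0 := by have := hn.1; omega
  have hcomp := hn.one_le_complexity hL
  have hl0 : 0 < Real.log (2 / α) := Real.log_pos (by rw [lt_div_iff₀ hα]; linarith)
  have := H.isProbabilityMeasure_map
  have hfL := memLp_two_of_bounded H.measurable_f H.bounded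
  have hcL : ∀ θ : Param p L r, MemLp (clipped C θ) 2 (P.map X) := fun θ =>
    memLp_two_of_bounded (measurable_clipped C θ) (ae_of_all _ (abs_clipped_le hC0 θ))
  obtain ⟨G, hG, hGP, hGk⟩ := H.exists_oracle_event hD hΞ hK hB hρ hρ1 hp hL hr hn hθs hα
  refine le_measure_of_le_map hD.aemeasurable hG hGP fun ω hω => ?_
  set d : Fin n → EuclideanSpace ℝ (Fin p) × ℝ := fun i => D i ω
  have := isProbabilityMeasure_surrogatePosterior (C := C) (L := L) (r := r) hn1 hΞ0 hB0 hρ hρ1 d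
  have hmL : MemLp (posteriorMean L r C B (n / Ξ) ρ d) 2 (P.map X) :=
    memLp_two_of_bounded (measurable_posteriorMean hn1 hΞ0 hB0 hρ hρ1 d)
      (ae_of_all _ (abs_posteriorMean_le hC0 hn1 hΞ0 hB0 hρ hρ1 d))
  set Q := 2 * rateSq C Ξ' n (P.map X) f θs + 4 * Ξ' / n * Real.log (2 / α) with hQ
  set R := 12 * sqDist (P.map X) f (clipped C θs)
    + Ξ' / n * (numParams p L r * L * Real.log n) with hR
  have hrate : rateSq C Ξ' n (P.map X) f θs = R := by
    rw [rateSq, sq_l2Norm_sub ((hcL θs).sub hfL)]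
  have hn0 : (0 : ℝ) < n := by positivity
  have hΞ'0 : 0 < Ξ' := by linarith
  have hR0 : 0 ≤ R := by
    have := sqDist_nonneg (P.map X) f (clipped C θs)
    positivity
  have hQ0 : 0 < Q := by
    rw [hQ, hrate]
    positivity
  obtain ⟨hdraw, hmean⟩ := hGk d hω
  have hmean' : sqDist (P.map X) f (posteriorMean L r C B (n / Ξ) ρ d)
      ≤ R + Ξ' / n * Real.log (2 / α) := by
    refine hmean.trans ?_
    calc _ = 12 * sqDist (P.map X) f (clipped C θs)
        + (28 * Ξ + 192) / n * (numParams p L r * L * Real.log n)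
        + 8 * Ξ / n * Real.log (2 / α) := by ring
      _ ≤ 12 * sqDist (P.map X) f (clipped C θs) + Ξ' / n * (numParams p L r * L * Real.log n)
        + Ξ' / n * Real.log (2 / α) := by
        gcongr
        linarith
  -- The draw and the posterior mean are both within squared distance `R + (Ξ'/n) log (2/α)` of `f`,
  -- so their squared distance is at most four times this, hence at most `4Q`. The tail level `α/2`
  -- gives mass `1 - α/2`, strictly above `1 - α`.
  have hmem : (2 * √Q) ∈ {τ : ℝ | 0 < τ ∧ 1 - α < (surrogatePosterior L r C B (n / Ξ) ρ d).real
      {θ | l2Norm (P.map X) (fun x => clipped C θ x - posteriorMean L r C B (n / Ξ) ρ d x)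
        ≤ τ}} := by
    refine ⟨by positivity, ?_⟩
    have h2 : ENNReal.ofReal (1 - α / 2) ≤ surrogatePosterior L r C B (n / Ξ) ρ d
        {θ | l2Norm (P.map X) (fun x => clipped C θ x - posteriorMean L r C B (n / Ξ) ρ d x)
          ≤ 2 * √Q} := by
      refine (ofReal_one_sub_le_of_compl (half_pos hα).le (hdraw (α / 2) (half_pos hα))).trans
        (measure_mono fun θ hθ => ?_)
      have hθ' : sqDist (P.map X) f (clipped C θ) ≤ R + Ξ' / n * Real.log (2 / α) := by
        refine le_trans (Set.mem_ofPred_eq ▸ hθ) ?_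
        rw [show 1 / (α / 2) = 2 / α by field_simp]
        calc _ = 12 * sqDist (P.map X) f (clipped C θs)
            + (28 * Ξ + 192) / n * (numParams p L r * L * Real.log n)
            + 12 * Ξ / n * Real.log (2 / α) := by ring
          _ ≤ 12 * sqDist (P.map X) f (clipped C θs)
            + Ξ' / n * (numParams p L r * L * Real.log n) + Ξ' / n * Real.log (2 / α) := by
            gcongr
            linarith
      rw [Set.mem_ofPred_eq, ← sq_le_sq₀ (l2Norm_nonneg _) (by positivity),
        sq_l2Norm_sub ((hcL θ).sub hmL), mul_pow, Real.sq_sqrt hQ0.le, hQ, hrate]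
      have h3 := sqDist_le_two_mul hfL hmL (hcL θ)
      have h4 : 4 * Ξ' / n * Real.log (2 / α) = 4 * (Ξ' / n * Real.log (2 / α)) := by ring
      have h5 : 0 ≤ Ξ' / n * Real.log (2 / α) := by positivity
      rw [h4]
      linarith
    have h3 := (ENNReal.ofReal_le_iff_le_toReal (measure_ne_top _ _)).1 h2
    exact lt_of_lt_of_le (by linarith) h3
  have hcrit : criticalValue L r C B (n / Ξ) ρ (P.map X) d α ≤ 2 * √Q :=
    csInf_le ⟨0, fun τ hτ => hτ.1.le⟩ hmem
  refine (l2Diam_l2Ball_le hmL).trans (ENNReal.ofReal_le_ofReal ?_)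
  linarith

/-- The coverage of the inflated credible ball. -/
theorem IsBoundedRegression.coverage (H : IsBoundedRegression P X Y f C K σ Γ)
    (hD : IsSample P X Y D) (hΞ : IsTemperature C σ Γ Ξ) (hK : 1 ≤ K) (hB : 1 ≤ B) (hρ : 0 < ρ)
    (hρ1 : ρ ≤ 1) (hp : 1 ≤ p) (hL : 1 ≤ L) (hr : 1 ≤ r) (hn : IsLargeSample n p L r B K)
    (hθs : θs ∈ cube p L r B) {A α ζ κ : ℝ} (hα : 0 < α) (hα1 : α < 1) (hA : 0 ≤ A)
    (hrisk : sqDist (P.map X) f (clipped C θs) ≤ A * Ξ * numParams p L r / n)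
    (hζ : ζ = (1 - α) * α ^ 2 / (32 * Real.exp (3 * A + 48 * p * K / Ξ))) (hκ0 : 0 ≤ κ)
    (hκ : 24 * A * Ξ + 28 * Ξ + 192 + 16 * Ξ * Real.log (4 / α) ≤ (κ * ζ) ^ 2) :
    ENNReal.ofReal (1 - α) ≤ P {ω | f ∈ credibleBall L r C B (n / Ξ) ρ (P.map X) (fun i => D i ω)
      (κ * √(L * Real.log n) * paramCriticalValue L r C B (n / Ξ) ρ (fun i => D i ω) α)} := by
  have hC0 := hΞ.C_pos.le
  have hΞ0 := hΞ.pos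
  have hB0 : 0 < B := by linarith
  have hr' : (1 : ℝ) ≤ r := by exact_mod_cast hr
  have hL' : (1 : ℝ) ≤ L := by exact_mod_cast hL
  have hn1 : n ≠ 0 := by have := hn.1; omega
  have hn0 : (0 : ℝ) < n := by positivity
  have hcomp := hn.one_le_complexity hL
  have hlog := hn.half_le_log
  have := H.isProbabilityMeasure_map
  have : IsProbabilityMeasure (P.map fun ω i => D i ω) :=
    Measure.isProbabilityMeasure_map hD.aemeasurable
  have hα' : 0 < 1 - α := by linarith
  have hζ0 : 0 < ζ := by rw [hζ]; positivity
  -- For `δ = α/2` the prefactor `4/δ²` is `16/α²`, so this `ζ` makes the bound on the small-ball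
  -- mass exactly `1 - α`.
  have hζe : 2 * ζ * Real.exp (3 * A + 48 * p * K / Ξ) = (1 - α) * α ^ 2 / 16 := by
    rw [hζ]
    field_simp
    norm_num
  have hα2 : α ^ 2 ≤ 1 := pow_le_one₀ hα.le hα1.le
  have hfL := memLp_two_of_bounded H.measurable_f H.bounded
  obtain ⟨G₁, hG₁, hG₁P, hG₁k⟩ := H.exists_oracle_event hD hΞ hK hB hρ hρ1 hp hL hr hn hθs
    (half_pos hα)
  obtain ⟨G₂, hG₂, hG₂P, hG₂k⟩ := H.exists_small_ball_event hD hΞ hK hB hρ hρ1 hp hL hr hn hθs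
    hrisk (half_pos hα) hζ0 (η := 1 - α)
    (by
      rw [hζe]
      refine le_of_eq ?_
      field_simp
      norm_num)
    (by rw [hζe]; nlinarith)
  refine le_measure_of_le_map hD.aemeasurable (hG₁.inter hG₂)
    (one_sub_le_measure_inter hG₁ hG₂ hα.le hG₁P hG₂P) fun ω hω => ?_
  set d : Fin n → EuclideanSpace ℝ (Fin p) × ℝ := fun i => D i ω
  have := isProbabilityMeasure_surrogatePosterior (C := C) (L := L) (r := r) hn1 hΞ0 hB0 hρ hρ1 d
  have hmL : MemLp (posteriorMean L r C B (n / Ξ) ρ d) 2 (P.map X) :=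
    memLp_two_of_bounded (measurable_posteriorMean hn1 hΞ0 hB0 hρ hρ1 d)
      (ae_of_all _ (abs_posteriorMean_le hC0 hn1 hΞ0 hB0 hρ hρ1 d))
  have hcrit : ζ * √(numParams p L r / n) ≤ paramCriticalValue L r C B (n / Ξ) ρ d α := by
    have hpos : 0 < (2 * (r : ℝ) * B) ^ L := by positivity
    -- A lower bound on `sInf` needs a nonempty set. The witness corresponds to `‖θ‖ ≤ B`, which has
    -- full posterior mass.
    refine le_csInf ⟨(2 * (r : ℝ) * B) ^ L * B, by positivity, ?_⟩ fun τ hτ => ?_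
    · rw [inv_mul_cancel_left₀ hpos.ne', surrogatePosterior_closedBall hn1 hΞ0 hB0 hρ hρ1 d]
      linarith
    · by_contra! hlt
      have hsub : {θ : Param p L r | ‖θ‖ ≤ ((2 * (r : ℝ) * B) ^ L)⁻¹ * τ} ⊆
          {θ | ‖θ‖ ≤ ((2 * (r : ℝ) * B) ^ L)⁻¹ * (ζ * √(numParams p L r / n))} := by
        intro θ hθ
        rw [Set.mem_ofPred_eq] at hθ ⊢
        refine hθ.trans ?_
        gcongr
      have h1 : surrogatePosterior L r C B (n / Ξ) ρ d
          {θ | ‖θ‖ ≤ ((2 * (r : ℝ) * B) ^ L)⁻¹ * τ} ≤ ENNReal.ofReal (1 - α) :=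
        (measure_mono hsub).trans (hG₂k d hω.2)
      have h2 := ENNReal.toReal_le_of_le_ofReal hα'.le h1
      exact absurd hτ.2 (not_lt.2 h2)
  refine ⟨hfL, ?_⟩
  have hmean := (hG₁k d hω.1).2
  set N : ℝ := numParams p L r * L * Real.log n / n with hN
  have hl : Real.log (2 / (α / 2)) = Real.log (4 / α) := by
    congr 1
    field_simp
    norm_num
  have hl0 : 0 ≤ Real.log (4 / α) := Real.log_nonneg (by rw [le_div_iff₀ hα]; linarith)
  -- Because `P L log n` and `L log n` are at least `1/2`, terms of order `1/n` and `P/n` are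
  -- absorbed into `N` at the price of a factor 2.
  have hN1 : 1 / n ≤ 2 * N := by
    rw [hN, ← mul_div_assoc]
    gcongr
    linarith
  have hN2 : (numParams p L r : ℝ) / n ≤ 2 * N := by
    rw [hN, ← mul_div_assoc]
    gcongr
    have : (0 : ℝ) ≤ numParams p L r := by positivity
    nlinarith [mul_le_mul hL' hlog (by norm_num) (by linarith)]
  have hsq : sqDist (P.map X) f (posteriorMean L r C B (n / Ξ) ρ d) ≤ (κ * ζ) ^ 2 * N := by
    rw [hl] at hmean
    calc _ ≤ _ := hmean
      _ ≤ 12 * (A * Ξ * numParams p L r / n)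
          + (28 * Ξ + 192) / n * (numParams p L r * L * Real.log n)
          + 4 * Ξ / n * (2 * Real.log (4 / α)) := by gcongr
      _ = 12 * (A * Ξ) * (numParams p L r / n) + (28 * Ξ + 192) * N
          + 8 * Ξ * Real.log (4 / α) * (1 / n) := by
          rw [hN]
          ring
      _ ≤ 12 * (A * Ξ) * (2 * N) + (28 * Ξ + 192) * N + 8 * Ξ * Real.log (4 / α) * (2 * N) := by
          gcongr
      _ = (24 * A * Ξ + 28 * Ξ + 192 + 16 * Ξ * Real.log (4 / α)) * N := by ring
      _ ≤ _ := by gcongr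
  calc l2Norm (P.map X) (fun x => f x - posteriorMean L r C B (n / Ξ) ρ d x)
      ≤ κ * √(L * Real.log n) * (ζ * √(numParams p L r / n)) := by
        refine abs_le_of_sq_le_sq' ?_ (by positivity) |>.2
        rw [sq_l2Norm_sub (hfL.sub hmL), sqDist_comm]
        refine hsq.trans (le_of_eq ?_)
        simp only [mul_pow]
        rw [Real.sq_sqrt (by positivity),
          Real.sq_sqrt (by positivity), hN]
        ring
    _ ≤ _ := by gcongr

end Main


end CredibleBalls

/-! ### Choice of the constants -/

theorem mainTheorem5 (C σ Γ : ℝ) (hC : 1 ≤ C) (hσ : 0 < σ) (hΓ : 0 < Γ) :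
    ∃ Ξ₀ > (0 : ℝ), ∃ Ξ₁ > (0 : ℝ), ∃ Ξ₂ > (0 : ℝ),
      -- the oracle inequalities characterizing the constants, and the diameter bound
      (∀ (K B ρ : ℝ) (p L r n : ℕ), 1 ≤ K → 1 ≤ B → 0 < ρ → ρ ≤ 1 → 1 ≤ p → 1 ≤ L → 1 ≤ r →
        IsLargeSample n p L r B K →
        ∀ (Ω : Type*) [MeasurableSpace Ω] (P : Measure Ω) [IsProbabilityMeasure P]
          (X : Ω → EuclideanSpace ℝ (Fin p)) (Y : Ω → ℝ) (f : EuclideanSpace ℝ (Fin p) → ℝ)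
          (D : Fin n → Ω → EuclideanSpace ℝ (Fin p) × ℝ) (θs : Param p L r),
          IsBoundedRegression P X Y f C K σ Γ → IsSample P X Y D → IsOracle P X Y C B θs →
          (∀ δ : ℝ, 0 < δ → δ < 1 →
            ENNReal.ofReal (1 - δ) ≤
              ∫⁻ ω, surrogatePosterior L r C B (n / Ξ₀) ρ (fun i => D i ω)
                {θ | excessRisk P X Y f (clipped C θ) ≤
                  12 * excessRisk P X Y f (clipped C θs)
                    + Ξ₁ / n * (numParams p L r * L * Real.log n + Real.log (2 / δ))} ∂P) ∧
          (∀ δ : ℝ, 0 < δ → δ < 1 →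
            ENNReal.ofReal (1 - δ) ≤
              P {ω | excessRisk P X Y f (posteriorMean L r C B (n / Ξ₀) ρ (fun i => D i ω)) ≤
                12 * excessRisk P X Y f (clipped C θs)
                  + Ξ₂ / n * (numParams p L r * L * Real.log n + Real.log (2 / δ))}) ∧
          (∀ α : ℝ, 0 < α → α < 1 →
            ENNReal.ofReal (1 - α) ≤
              P {ω | l2Diam (P.map X)
                  (credibleBall L r C B (n / (2 * Ξ₀)) ρ (P.map X) (fun i => D i ω)
                    (criticalValue L r C B (n / (2 * Ξ₀)) ρ (P.map X) (fun i => D i ω) α)) ≤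
                ENNReal.ofReal (4 * √(2 * rateSq C Ξ₁ n (P.map X) f θs
                  + 4 * max Ξ₁ Ξ₂ / n * Real.log (2 / α)))})) ∧
      -- the coverage of the inflated ball
      (∀ (K : ℝ) (p : ℕ) (α A : ℝ), 1 ≤ K → 1 ≤ p → 0 < α → α < 1 → 0 < A →
        ∃ κ > (1 : ℝ), ∀ (B ρ : ℝ) (L r n : ℕ), 1 ≤ B → 0 < ρ → ρ ≤ 1 → 1 ≤ L → 1 ≤ r →
          IsLargeSample n p L r B K →
          ∀ (Ω : Type*) [MeasurableSpace Ω] (P : Measure Ω) [IsProbabilityMeasure P]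
            (X : Ω → EuclideanSpace ℝ (Fin p)) (Y : Ω → ℝ) (f : EuclideanSpace ℝ (Fin p) → ℝ)
            (D : Fin n → Ω → EuclideanSpace ℝ (Fin p) × ℝ) (θs : Param p L r),
            IsBoundedRegression P X Y f C K σ Γ → IsSample P X Y D → IsOracle P X Y C B θs →
            L * Real.log n * excessRisk P X Y f (clipped C θs) ≤
              A * (numParams p L r * L * Real.log n / (n / (2 * Ξ₀))) →
            ENNReal.ofReal (1 - α) ≤
              P {ω | f ∈ credibleBall L r C B (n / (2 * Ξ₀)) ρ (P.map X) (fun i => D i ω)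
                (κ * √(L * Real.log n) *
                  paramCriticalValue L r C B (n / (2 * Ξ₀)) ρ (fun i => D i ω) α)}) := by
  set Ξ₀ := 8 * C * Γ + 32 * C ^ 2 + 256 * σ ^ 2 with hΞ₀
  have hC0 : 0 < C := by linarith
  have hΞ₀0 : 0 < Ξ₀ := by positivity
  have hT : IsTemperature C σ Γ Ξ₀ := ⟨le_rfl, hC0, hΓ⟩
  have hT2 : IsTemperature C σ Γ (2 * Ξ₀) := ⟨by linarith, hC0, hΓ⟩
  have hle : 28 * Ξ₀ + 192 ≤ 56 * Ξ₀ + 192 := by linarith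
  have hle2 : 28 * (2 * Ξ₀) + 192 ≤ 56 * Ξ₀ + 192 := by linarith
  -- The rate constant `28Ξ + 192` is taken at the larger temperature `Ξ = 2Ξ₀`, so it serves both
  -- `λ = n/Ξ₀` and `λ = n/(2Ξ₀)`.
  refine ⟨Ξ₀, hΞ₀0, 56 * Ξ₀ + 192, by positivity, 56 * Ξ₀ + 192, by positivity, ?_, ?_⟩
  · intro K B ρ p L r n hK hB hρ hρ1 hp hL hr hn Ω _ P _ X Y f D θs H hD hθs
    refine ⟨fun δ hδ hδ1 => H.oracle_draw hD hT hK hB hρ hρ1 hp hL hr hn hθs.1 hle hδ hδ1,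
      fun δ hδ hδ1 => H.oracle_mean hD hT hK hB hρ hρ1 hp hL hr hn hθs.1 hle hδ hδ1,
      fun α hα hα1 => ?_⟩
    rw [max_self]
    exact H.diam_credibleBall_le hD hT2 hK hB hρ hρ1 hp hL hr hn hθs.1 hle2 hα hα1
  · intro K p α A hK hp hα hα1 hA
    set ζ := (1 - α) * α ^ 2 / (32 * Real.exp (3 * A + 48 * p * K / (2 * Ξ₀))) with hζ
    have hα' : 0 < 1 - α := by linarith
    have hζ0 : 0 < ζ := by positivity
    set c := 24 * A * (2 * Ξ₀) + 28 * (2 * Ξ₀) + 192 + 16 * (2 * Ξ₀) * Real.log (4 / α) with hc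
    have hl0 : 0 ≤ Real.log (4 / α) := Real.log_nonneg (by rw [le_div_iff₀ hα]; linarith)
    have hc0 : 0 < c := by positivity
    have hs0 : 0 < √c / ζ := div_pos (Real.sqrt_pos.2 hc0) hζ0
    -- Coverage requires `(κζ)² ≥ c`, which `√c / ζ` already attains; the summand 1 ensures `κ > 1`.
    refine ⟨√c / ζ + 1, by linarith, ?_⟩
    intro B ρ L r n hB hρ hρ1 hL hr hn Ω _ P _ X Y f D θs H hD hθs hrisk
    rw [H.excessRisk_eq (measurable_clipped C θs) (abs_clipped_le hC0.le θs)] at hrisk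
    have hlog := hn.half_le_log
    have hL' : (1 : ℝ) ≤ L := by exact_mod_cast hL
    have hn0 : (0 : ℝ) < n := by exact_mod_cast (by have := hn.1; omega : 0 < n)
    -- The factor `L log n > 0` cancels from the risk assumption and leaves oracle risk of order
    -- `P/n`.
    have hrisk' : sqDist (P.map X) f (clipped C θs) ≤ A * (2 * Ξ₀) * numParams p L r / n := by
      have hLn : 0 < L * Real.log n := mul_pos (by linarith) (by linarith)
      refine le_of_mul_le_mul_left (hrisk.trans (le_of_eq ?_)) hLn
      field_simp
    refine H.coverage hD hT2 hK hB hρ hρ1 hp hL hr hn hθs.1 hα hα1 hA.le hrisk' hζ (by linarith) ?_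
    calc c = (√c / ζ * ζ) ^ 2 := by rw [div_mul_cancel₀ _ hζ0.ne', Real.sq_sqrt hc0.le]
      _ ≤ _ := by
        gcongr
        linarith
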